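/- Let $S'\subset\mathbb{R}^3$ be a compact (topological, embedded) 2-manifold with boundary. For a viewpoint $V$ (a point of $\mathbb{R}^3$, or a point at infinity given by a direction), a ray $R$ from $V$ (a whole line if $V$ is at infinity) is tangent to $S'$ in a non-crossing way along a connected component $K$ of $R\cap S'$ if some open segment $u\subset R$ contains $K$, avoids the boundary of $S'$, and stays (locally) on one side of $S'$. The silhouette of $S'$ from $V$ consists of the boundary of $S'$ and of the points closest to $V$ on all components $K$ along which the ray is tangent in a non-crossing way. For $V$ at infinity, the length of the silhouette is the length of its orthogonal projection along the direction of $V$ onto a plane, counted with multiplicity. Assume that the boundary of $S'$ has finite length (one-dimensional Hausdorff measure) and that the average length of the silhouette of $S'$, over all viewpoints at infinity (uniform on the sphere of directions), is finite. Let $\alpha,\beta>0$ and let $B$ be a ball in $\mathbb{R}^3$. Then there is a constant $C$, depending only on $S'$, $\alpha$, $\beta$ and $B$, such that the following holds for all $n$. Let $P_n$ be a triangle mesh in $\mathbb{R}^3$ with exactly $n$ triangular faces (a finite simplicial complex in which every face lies in a triangle and every edge is adjacent to one or two triangles), and let $f_n:P_n\to S'$ be a homeomorphism such that 1. every edge of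 $P_n$ has length at least $\alpha/\sqrt n$, and 2. every point $x$ of $P_n$ satisfies $d(x,f_n(x))<\beta\,h(x)/\sqrt n$, where $h(x)$ is the smallest height of the triangle(s) of $P_n$ containing $x$. Then, for a viewpoint chosen uniformly at random in $B$, the expected number of edges of the silhouette of $P_n$ is at most $C\sqrt n$. Here the silhouette of $P_n$ consists of the edges adjacent to a front face and a back face, and of all boundary edges (the edges adjacent to only one face). If the viewpoint lies in the plane of a face adjacent to a non-boundary edge, then this edge also belongs to the silhouette if an interior point of the edge is on the silhouette of the surface $P_n$ in the above sense; such viewpoints have probability zero. -/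

import Mathlib

open MeasureTheory Metric Set
open scoped ENNReal

noncomputable section

/-- Euclidean three-space. -/
abbrev E3 : Type := EuclideanSpace ℝ (Fin 3)

/-! ### Surfaces with boundary in space -/

/-- `S ⊆ ℝ³` is a compact (topological, embedded) 2-manifold with (possibly empty) boundary:
it is compact and, with the subspace topology, locally homeomorphic to a half-plane. -/
def IsCompactSurface (S : Set E3) : Prop :=
  IsCompact S ∧ Nonempty (ChartedSpace (EuclideanHalfSpace 2) S)

/-- The manifold boundary of `S`: the points of `S` that have no open neighbourhood in `S` that is
homeomorphic to an open subset of the plane. -/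
def surfaceBoundary (S : Set E3) : Set E3 :=
  {x | ∃ hx : x ∈ S, ∀ φ : OpenPartialHomeomorph S (EuclideanSpace ℝ (Fin 2)),
    (⟨x, hx⟩ : S) ∉ φ.source}

/-! ### Viewpoints and rays -/

/-- A viewpoint is a point of space, or a point at infinity given by a unit direction. -/
inductive Viewpoint : Type
  | finite (V : E3)
  | atInfinity (d : sphere (0 : E3) 1)

/-- The ray that starts at the viewpoint and passes through `x`.  From a viewpoint at infinity in
direction `d` this is the whole line through `x` parallel to `d`. -/
def Viewpoint.ray : Viewpoint → E3 → Set E3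
  | .finite V, x => {y | ∃ t : ℝ, 0 ≤ t ∧ y = V + t • (x - V)}
  | .atInfinity d, x => {y | ∃ t : ℝ, y = x + t • (d : E3)}

/-- A function that orders the points of a ray by their distance from the viewpoint. -/
def Viewpoint.depth : Viewpoint → E3 → ℝ
  | .finite V, y => dist V y
  | .atInfinity d, y => - inner ℝ (d : E3) y

/-! ### The (transparent) silhouette of a surface -/

/-- The ray `R` is tangent to `S` in a non-crossing way along `K` (a connected component of
`R ∩ S`): some open segment `u` of `R` contains `K`, does not meet the boundary of `S`, and stays on
one side of `S`.

"One side of `S`" is a local notion, so that it makes sense for a surface with boundary, whose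
complement need not be disconnected: in every open neighbourhood `W` of `u`, the segment `u` lies
in the closure of a connected part `A` of `W \ S`.  If `S` has no boundary and thus separates space
into two open regions, then this says that `u` is contained in the closure of one of the
two regions. -/
def NonCrossingAlong (S R K : Set E3) : Prop :=
  ∃ a ∈ R, ∃ b ∈ R, a ≠ b ∧ openSegment ℝ a b ⊆ R ∧ K ⊆ openSegment ℝ a b ∧
    Disjoint (openSegment ℝ a b) (surfaceBoundary S) ∧
    ∀ W : Set E3, IsOpen W → openSegment ℝ a b ⊆ W →
      ∃ A : Set E3, IsPreconnected A ∧ A ⊆ W \ S ∧ openSegment ℝ a b ⊆ closure A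

/-- The silhouette of `S` from the viewpoint `v`, as a set of points: on every ray from `v`, and for
every connected component of its intersection with `S` along which the ray is tangent to `S` in a
non-crossing way, the point of the component closest to `v`; together with the boundary
of `S`. -/
def silhouetteSet (S : Set E3) (v : Viewpoint) : Set E3 :=
  {p | p ∈ S ∧ NonCrossingAlong S (v.ray p) (connectedComponentIn (v.ray p ∩ S) p) ∧
      ∀ q ∈ connectedComponentIn (v.ray p ∩ S) p, v.depth p ≤ v.depth q} ∪
    surfaceBoundary S

/-- The orthogonal projection of `x` along the unit direction `d`, onto the plane through the
origin orthogonal to `d`. -/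
def projAlong (d : sphere (0 : E3) 1) (x : E3) : E3 :=
  x - inner ℝ (d : E3) x • (d : E3)

/-- The (projected) length of the silhouette of `S` from the viewpoint at infinity in direction
`d`: the length of its projection along `d`, each point `y` of the projection being counted with
the number of points of the silhouette that project to `y`. -/
def silhouetteLength (S : Set E3) (d : sphere (0 : E3) 1) : ℝ≥0∞ :=
  ∫⁻ y, ((({p ∈ silhouetteSet S (.atInfinity d) | projAlong d p = y}).encard : ℕ∞) : ℝ≥0∞)
    ∂(Measure.hausdorffMeasure 1 : Measure E3)

/-- The average length of the silhouette of `S` over all viewpoints at infinity, with respect to the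
uniform (surface) measure on the sphere of directions. -/
def averageSilhouetteLength (S : Set E3) : ℝ≥0∞ :=
  ⨍⁻ d, silhouetteLength S d ∂((volume : Measure E3).toSphere)

/-! ### Triangle meshes -/

/-- `P` is a mesh with `n` triangular faces: a finite simplicial complex in space in which every
face is a face of a triangle, every edge is adjacent to at most two triangles, and which has exactly
`n` triangles.  (Simplices are given by their sets of vertices.) -/
structure IsTriangleMesh (P : Geometry.SimplicialComplex ℝ E3) (n : ℕ) : Prop where
  finite : P.faces.Finite
  pure : ∀ s ∈ P.faces, ∃ T ∈ P.faces, T.card = 3 ∧ s ⊆ T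
  adjacent_le_two : ∀ e ∈ P.faces, e.card = 2 →
    {T ∈ P.faces | T.card = 3 ∧ e ⊆ T}.encard ≤ 2
  card_triangles : {T ∈ P.faces | T.card = 3}.ncard = n

/-- The smallest height of the triangle with vertex set `T`: the smallest distance from a
vertex to the line that supports the opposite edge. -/
def minHeight (T : Finset E3) : ℝ :=
  ⨅ v : T, infDist (v : E3) (affineSpan ℝ ((T : Set E3) \ {(v : E3)}) : Set E3)

/-- The cross product in Euclidean three-space. -/
def cross (u v : E3) : E3 := WithLp.toLp 2 (crossProduct u.ofLp v.ofLp)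

/-- The normal vector of the triangle `a b c`, oriented by this order of its vertices. -/
def triNormal (a b c : E3) : E3 := cross (b - a) (c - a)

/-- The edge `e` of `P` is adjacent to exactly one triangle. -/
def IsBoundaryEdge (P : Geometry.SimplicialComplex ℝ E3) (e : Finset E3) : Prop :=
  ∃! T : Finset E3, T ∈ P.faces ∧ T.card = 3 ∧ e ⊆ T

open Classical in
/-- The edge `e` of `P` is adjacent to a front face `a b c₁` and to a back face `b a c₂` with respect
to the viewpoint `V`.  The two faces are consistently oriented, as they traverse the common edge in
opposite directions.  A face is a front (back) face if its normal makes an angle smaller (larger)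
than `π / 2` with a vector from a point of the face to the viewpoint. -/
def IsFrontBackEdge (P : Geometry.SimplicialComplex ℝ E3) (V : E3) (e : Finset E3) : Prop :=
  ∃ a b c₁ c₂ : E3, e = {a, b} ∧ c₁ ≠ c₂ ∧
    ({a, b, c₁} : Finset E3) ∈ P.faces ∧ ({a, b, c₁} : Finset E3).card = 3 ∧
    ({a, b, c₂} : Finset E3) ∈ P.faces ∧ ({a, b, c₂} : Finset E3).card = 3 ∧
    0 < inner ℝ (triNormal a b c₁) (V - a) ∧ inner ℝ (triNormal b a c₂) (V - b) < 0

open Classical in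
/-- The edge `e` of `P` is adjacent to a face whose plane contains the viewpoint `V`, and a
point in the interior of `e` is on the silhouette of the surface `|P|` from `V`. -/
def IsDegenerateSilhouetteEdge (P : Geometry.SimplicialComplex ℝ E3) (V : E3)
    (e : Finset E3) : Prop :=
  (∃ T ∈ P.faces, T.card = 3 ∧ e ⊆ T ∧ V ∈ affineSpan ℝ (T : Set E3)) ∧
    ∃ a b : E3, e = {a, b} ∧ (openSegment ℝ a b ∩ silhouetteSet P.space (.finite V)).Nonempty

/-- The silhouette of the mesh `P` from the viewpoint `V`: the boundary edges, the edges adjacent to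
a front face and a back face and, if `V` is in the plane of an adjacent face, the edges that are on
the silhouette in the sense of general surfaces. -/
def meshSilhouette (P : Geometry.SimplicialComplex ℝ E3) (V : E3) : Set (Finset E3) :=
  {e | e ∈ P.faces ∧ e.card = 2 ∧
    (IsBoundaryEdge P e ∨ IsFrontBackEdge P V e ∨ IsDegenerateSilhouetteEdge P V e)}

/-- The complexity of the silhouette of the mesh `P` from the viewpoint `V`: its number of edges. -/
def silhouetteComplexity (P : Geometry.SimplicialComplex ℝ E3) (V : E3) : ℝ≥0∞ :=
  (((meshSilhouette P V).encard : ℕ∞) : ℝ≥0∞)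

open Classical in
/-- No short edges: every edge of `P` has length at least `α / √n`. -/
def EdgeLengthHypothesis (P : Geometry.SimplicialComplex ℝ E3) (n : ℕ) (α : ℝ) : Prop :=
  ∀ a b : E3, a ≠ b → ({a, b} : Finset E3) ∈ P.faces → α / √(n : ℝ) ≤ dist a b

/-- Closeness: every point `x` of `P` satisfies `d(x, f(x)) < β h(x) / √n`, where `h(x)` is the
smallest height of the triangles of `P` that contain `x`. -/
def DistanceHypothesis (P : Geometry.SimplicialComplex ℝ E3) (n : ℕ) (β : ℝ) {S : Set E3}
    (f : P.space ≃ₜ S) : Prop :=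
  ∀ x : P.space, ∀ T ∈ P.faces, T.card = 3 → (x : E3) ∈ convexHull ℝ (T : Set E3) →
    dist (x : E3) (f x : E3) < β * minHeight T / √(n : ℝ)

end

/-! Edges are treated by type, and the count is integrated over the viewpoint. An edge with two
adjacent triangles lies between a front and a back face only for viewpoints in a double wedge
bounded by the planes of the triangles (`IsInteriorEdge.inner_mul_inner_pos`). The volume of this
wedge in a ball is bounded by a multiple of the spherical measure of its directions, where
directions within O(1/√n) of one of the two planes can be discarded at the cost of a thin slab
(`volume_wedge_le`). There are at most 3n edges, so the slabs contribute n · O(1/√n) = O(√n).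

From a remaining, transverse direction both triangles are seen on the same side of their common
edge, and `f` moves their points by a small fraction of their apparent heights. Slice the view
perpendicularly to the projected edge. In the middle third of the slices, the image of the edge
reaches farther out than the images of the other sides, so the outermost points of the image of the
two triangles come from the open star of the edge (`exists_extremal_silhouette`). On the line of
sight through such a point lies a silhouette point of `S` in the same piece
(`exists_mem_silhouetteSet`). Hence every transversely seen edge accounts for projected silhouette
length at least α/(12√n). A point of `S` is in the images of at most three open stars, so
integration over the directions bounds the total measure of transverse directions by O(√n) times the
integral of the silhouette length (`sum_toSphere_transverseDirections_le`).

Boundary edges are mapped into the manifold boundary of `S`: near an interior point of such an edge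
the mesh is a single triangle, and a winding number argument excludes a planar chart there
(`mem_surfaceBoundary_of_convex`). The images of the open boundary edges are disjoint, each of
length at least α/(2√n) once √n ≥ 4β, so their number is O(√n) (`boundaryEdges_le`). For smaller n
the trivial bound 3n is already O(√n). -/

/-! ### The circle is not null-homotopic in the punctured plane -/

/-- A continuous logarithm of a constant function on a connected space is constant. -/
theorem log_constant {X : Type*} [TopologicalSpace X] [PreconnectedSpace X] {k : X → ℂ}
    (hk : Continuous k) (h : ∀ x y, Complex.exp (k x) = Complex.exp (k y)) (x y : X) :
    k x = k y := by
  have hpi : (2 * (Real.pi : ℂ) * Complex.I) ≠ 0 := Complex.two_pi_I_ne_zero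
  choose n hn using fun z => Complex.exp_eq_exp_iff_exists_int.1 (h z y)
  -- The integer `n z` is the real part of (k z - k y)/(2πi), hence depends continuously on `z`; an
  -- integer-valued continuous function on a connected space is constant.
  have hcont : Continuous n := by
    have h1 : Continuous fun z => ((n z : ℤ) : ℝ) := by
      have h2 : (fun z => ((n z : ℤ) : ℝ)) =
          fun z => ((k z - k y) / (2 * (Real.pi : ℂ) * Complex.I)).re := by
        funext z
        have : (k z - k y) / (2 * (Real.pi : ℂ) * Complex.I) = ((n z : ℝ) : ℂ) := by
          rw [hn z]; field_simp; push_cast; ring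
        rw [this, Complex.ofReal_re]
      rw [h2]
      fun_prop
    exact Int.isClosedEmbedding_coe_real.isInducing.continuous_iff.2 h1
  have hxy : n x = n y := isPreconnected_univ.constant hcont.continuousOn (mem_univ x) (mem_univ y)
  rw [hn x, hxy, ← hn y]

/-- Lift the homotopy through `exp`, which is possible on all of the simply connected ℝ × ℝ. The
increment of the lift over a period is independent of `s`; it is 0 for the constant loop at `s = 1`,
but 2πi for the circle at `s = 0`. -/
theorem circle_not_nullhomotopic (K : ℝ × ℝ → ℂ) (hK : Continuous K) (h0 : ∀ p, K p ≠ 0)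
    (hper : ∀ s, K (s, 2 * Real.pi) = K (s, 0)) (ρ : ℂ)
    (hcirc : ∀ θ : ℝ, K (0, θ) = ρ * Complex.exp (θ * Complex.I))
    (hconst : ∀ θ, K (1, θ) = K (1, 0)) : False := by
  obtain ⟨F, ⟨-, hF⟩, -⟩ := Complex.isCoveringMapOn_exp.existsUnique_continuousMap_lifts
    (⟨K, hK⟩ : C(ℝ × ℝ, ℂ)) (a₀ := (0, 0)) (e₀ := Complex.log (K (0, 0)))
    (Complex.exp_log (h0 _)) (fun p => h0 p)
  have hF' : ∀ p, Complex.exp (F p) = K p := fun p => congrFun hF p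
  have hD := log_constant (k := fun s : ℝ => F (s, 2 * Real.pi) - F (s, 0)) (by fun_prop)
    (by intro s t; simp only [Complex.exp_sub, hF', hper, div_self (h0 _)]) 0 1
  have h1 := log_constant (k := fun θ : ℝ => F (1, θ)) (by fun_prop)
    (by intro s t; simp only [hF', hconst s, hconst t]) (2 * Real.pi) 0
  have h2 := log_constant (k := fun θ : ℝ => F (0, θ) - θ * Complex.I) (by fun_prop)
    (by
      intro s t
      simp only [Complex.exp_sub, hF', hcirc]
      field_simp) (2 * Real.pi) 0
  rw [h1, sub_self, sub_eq_zero] at hD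
  rw [hD] at h2
  have : (2 * (Real.pi : ℂ) * Complex.I) ≠ 0 := Complex.two_pi_I_ne_zero
  apply this
  push_cast at h2
  linear_combination -h2

/-! ### The manifold boundary -/

/-- If a neighbourhood of `x` in `P` is a convex set that has a supporting hyperplane at `x`, then
a homeomorphism from `P` to `S` maps `x` to the manifold boundary of `S`. -/
theorem mem_surfaceBoundary_of_convex {P S : Set E3} (f : P ≃ₜ S) (x : P) {Q O : Set E3}
    (hQ : Convex ℝ Q) (hQP : Q ⊆ P) (hO : IsOpen O) (hxO : (x : E3) ∈ O) (hPO : P ∩ O ⊆ Q)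
    (l : E3 →L[ℝ] ℝ) (hl : ∀ y ∈ Q, l x ≤ l y) {y₁ : E3} (hy₁ : y₁ ∈ Q) (hly : l x < l y₁) :
    (f x : E3) ∈ surfaceBoundary S := by
  refine ⟨(f x).2, fun φ hφ => ?_⟩
  -- Suppose that there is a planar chart at `f x`. A small circle around the chart point pulls back
  -- to a loop in `Q` that avoids `x`. It contracts inside `Q` without meeting `x`, and the chart
  -- turns this into a forbidden contraction in the punctured plane.
  replace hφ : f x ∈ φ.source := hφ
  let e : ℂ ≃ₗᵢ[ℝ] EuclideanSpace ℝ (Fin 2) := Complex.orthonormalBasisOneI.repr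
  -- a small convex neighbourhood of `x` in `P`
  have hsrc : IsOpen (f ⁻¹' φ.source) := φ.open_source.preimage f.continuous
  obtain ⟨O', hO', hO'eq⟩ := isOpen_induced_iff.1 hsrc
  have hxO' : (x : E3) ∈ O' := by
    have : x ∈ (Subtype.val ⁻¹' O' : Set P) := by rw [hO'eq]; exact hφ
    exact this
  obtain ⟨ε, hε, hball⟩ := Metric.isOpen_iff.1 (hO.inter hO') x ⟨hxO, hxO'⟩
  have hxQ : (x : E3) ∈ Q := hPO ⟨x.2, hxO⟩
  set Q' : Set E3 := Q ∩ ball (x : E3) ε with hQ'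
  have hQ'c : Convex ℝ Q' := hQ.inter (convex_ball _ _)
  have hQ'src : ∀ y (hy : y ∈ Q'), f ⟨y, hQP hy.1⟩ ∈ φ.source := by
    intro y hy
    have : (⟨y, hQP hy.1⟩ : P) ∈ (Subtype.val ⁻¹' O' : Set P) := (hball hy.2).2
    rw [hO'eq] at this
    exact this
  -- a point of the neighbourhood away from the hyperplane
  obtain ⟨y₀, hy₀, hly₀⟩ : ∃ y₀ ∈ Q', l x < l y₀ := by
    have hc : Continuous fun η : ℝ => (x : E3) + η • (y₁ - x) := by fun_prop
    have h1 : ∀ᶠ η in nhds (0 : ℝ), (x : E3) + η • (y₁ - x) ∈ ball (x : E3) ε := by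
      apply hc.continuousAt.eventually_mem
      simpa using ball_mem_nhds (x : E3) hε
    obtain ⟨η, ⟨h2, h3⟩, h4⟩ := (((h1.filter_mono nhdsWithin_le_nhds).and
      (Ioo_mem_nhdsGT (zero_lt_one (α := ℝ)))).and
        (self_mem_nhdsWithin (s := Ioi (0 : ℝ)) (a := 0))).exists
    refine ⟨(x : E3) + η • (y₁ - x), ⟨?_, h2⟩, ?_⟩
    · exact hQ.add_smul_sub_mem hxQ hy₁ ⟨h3.1.le, h3.2.le⟩
    · simp only [map_add, map_smul, map_sub, smul_eq_mul]
      have : 0 < η * (l y₁ - l x) := mul_pos h3.1 (by linarith)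
      linarith
  -- a small circle in the chart
  set z₀ : ℂ := e.symm (φ (f x)) with hz₀
  have hez₀ : e z₀ = φ (f x) := by simp [hz₀]
  have hk : ContinuousAt (fun z : ℂ => ((f.symm (φ.symm (e z)) : P) : E3)) z₀ := by
    have h1 : ContinuousAt φ.symm (e z₀) := by
      rw [hez₀]
      exact φ.continuousAt_symm (φ.map_source hφ)
    have h2 : ContinuousAt (fun z : ℂ => φ.symm (e z)) z₀ :=
      ContinuousAt.comp (f := e) h1 e.continuous.continuousAt
    exact (continuous_subtype_val.comp f.symm.continuous).continuousAt.comp h2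
  have hkz₀ : ((f.symm (φ.symm (e z₀)) : P) : E3) = x := by
    rw [hez₀, φ.left_inv hφ, f.symm_apply_apply]
  have hev : ∀ᶠ z in nhds z₀, ((f.symm (φ.symm (e z)) : P) : E3) ∈ O ∩ ball (x : E3) ε := by
    apply hk.eventually_mem
    rw [hkz₀]
    exact (hO.inter isOpen_ball).mem_nhds ⟨hxO, mem_ball_self hε⟩
  have hev2 : ∀ᶠ z in nhds z₀, e z ∈ φ.target := by
    apply e.continuous.continuousAt.eventually_mem
    rw [hez₀]
    exact φ.open_target.mem_nhds (φ.map_source hφ)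
  obtain ⟨r, hr, hrball⟩ := Metric.eventually_nhds_iff.1 (hev.and hev2)
  let c : ℝ → ℂ := fun θ => z₀ + (r / 2 : ℝ) * Complex.exp (θ * Complex.I)
  have hcnorm : ∀ θ, dist (c θ) z₀ = r / 2 := by
    intro θ
    simp only [c, dist_eq_norm, add_sub_cancel_left, norm_mul, Complex.norm_exp_ofReal_mul_I,
      Complex.norm_real, mul_one, Real.norm_eq_abs]
    exact abs_of_pos (by linarith)
  have hcball : ∀ θ, dist (c θ) z₀ < r := fun θ => by rw [hcnorm]; linarith
  have hcne : ∀ θ, c θ ≠ z₀ := fun θ h => by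
    have := hcnorm θ
    rw [h, dist_self] at this
    linarith
  have hccont : Continuous c := by fun_prop
  let k : ℝ → E3 := fun θ => ((f.symm (φ.symm (e (c θ))) : P) : E3)
  have hkcont : Continuous k := by
    have h1 : Continuous fun θ => φ.symm (e (c θ)) :=
      φ.continuousOn_symm.comp_continuous (e.continuous.comp hccont)
        (fun θ => (hrball (hcball θ)).2)
    exact continuous_subtype_val.comp (f.symm.continuous.comp h1)
  have hkQ : ∀ θ, k θ ∈ Q' := fun θ =>
    ⟨hPO ⟨(f.symm (φ.symm (e (c θ)))).2, (hrball (hcball θ)).1.1⟩, (hrball (hcball θ)).1.2⟩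
  have hgk : ∀ θ, φ (f ⟨k θ, hQP (hkQ θ).1⟩) = e (c θ) := by
    intro θ
    have : (⟨k θ, hQP (hkQ θ).1⟩ : P) = f.symm (φ.symm (e (c θ))) := rfl
    rw [this, f.apply_symm_apply, φ.right_inv (hrball (hcball θ)).2]
  have hkne : ∀ θ, k θ ≠ x := by
    intro θ h
    have h1 := hgk θ
    have h2 : (⟨k θ, hQP (hkQ θ).1⟩ : P) = x := Subtype.ext h
    rw [h2, ← hez₀] at h1
    exact hcne θ (e.injective h1.symm)
  -- contract the circle to `y₀`
  let σ : ℝ → ℝ := fun s => (projIcc (0 : ℝ) 1 zero_le_one s : ℝ)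
  have hσcont : Continuous σ := continuous_subtype_val.comp continuous_projIcc
  have hσ : ∀ s, σ s ∈ Icc (0 : ℝ) 1 := fun s => (projIcc (0 : ℝ) 1 zero_le_one s).2
  let H : ℝ × ℝ → E3 := fun p => (1 - σ p.1) • k p.2 + σ p.1 • y₀
  have hHQ : ∀ p, H p ∈ Q' := fun p =>
    hQ'c (hkQ p.2) hy₀ (by linarith [(hσ p.1).2]) (hσ p.1).1 (by ring)
  have hHcont : Continuous H := by fun_prop
  -- At parameter 0 the homotopy is the loop itself, which avoids `x`. Afterwards the positive share
  -- of `y₀` puts the point strictly inside the supporting half-space.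
  have hHne : ∀ p, H p ≠ x := by
    intro p h
    rcases (hσ p.1).1.eq_or_lt with h0 | h0
    · apply hkne p.2
      simpa [H, ← h0] using h
    · have h1 : l (H p) = l x := by rw [h]
      simp only [H, map_add, map_smul, smul_eq_mul] at h1
      have h2 := hl _ (hkQ p.2).1
      have h3 : 0 ≤ (1 - σ p.1) * (l (k p.2) - l x) :=
        mul_nonneg (by linarith [(hσ p.1).2]) (by linarith)
      have h4 : 0 < σ p.1 * (l y₀ - l x) := mul_pos h0 (by linarith)
      nlinarith
  have hφH : Continuous fun p => φ (f ⟨H p, hQP (hHQ p).1⟩) :=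
    φ.continuousOn.comp_continuous (f.continuous.comp (hHcont.subtype_mk _))
      (fun p => hQ'src _ (hHQ p))
  refine circle_not_nullhomotopic (fun p => e.symm (φ (f ⟨H p, hQP (hHQ p).1⟩)) - z₀)
    ((e.symm.continuous.comp hφH).sub continuous_const) ?_ ?_ (r / 2 : ℝ) ?_ ?_
  · intro p h
    rw [sub_eq_zero, hz₀] at h
    have h1 := φ.injOn (hQ'src _ (hHQ p)) hφ (e.symm.injective h)
    exact hHne p (congrArg Subtype.val (f.injective h1))
  · intro s
    have : k (2 * Real.pi) = k 0 := by
      simp only [k, c]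
      push_cast
      rw [Complex.exp_two_pi_mul_I]
      simp
    simp only [H, this]
  · intro θ
    have h1 : H (0, θ) = k θ := by simp [H, σ]
    simp only [h1, hgk]
    simp [c]
  · intro θ
    have h1 : ∀ θ, H (1, θ) = y₀ := fun θ => by simp [H, σ]
    simp only [h1]

/-- The manifold boundary of `S` is closed in `S`. -/
theorem exists_open_inter_surfaceBoundary (S : Set E3) :
    ∃ O : Set E3, IsOpen O ∧ S \ surfaceBoundary S = S ∩ O := by
  have h : IsOpen {x : S | ∃ φ : OpenPartialHomeomorph S (EuclideanSpace ℝ (Fin 2)),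
      x ∈ φ.source} := by
    rw [show {x : S | ∃ φ : OpenPartialHomeomorph S (EuclideanSpace ℝ (Fin 2)), x ∈ φ.source} =
      ⋃ φ : OpenPartialHomeomorph S (EuclideanSpace ℝ (Fin 2)), φ.source by ext; simp]
    exact isOpen_iUnion fun φ => φ.open_source
  obtain ⟨O, hO, hOe⟩ := isOpen_induced_iff.1 h
  refine ⟨O, hO, ?_⟩
  ext x
  constructor
  · rintro ⟨hx, hb⟩
    refine ⟨hx, ?_⟩
    have : (⟨x, hx⟩ : S) ∈ (Subtype.val ⁻¹' O : Set S) := by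
      rw [hOe]
      by_contra hcon
      exact hb ⟨hx, fun φ hφ => hcon ⟨φ, hφ⟩⟩
    exact this
  · rintro ⟨hx, hO'⟩
    refine ⟨hx, fun ⟨_, hb⟩ => ?_⟩
    have : (⟨x, hx⟩ : S) ∈ (Subtype.val ⁻¹' O : Set S) := hO'
    rw [hOe] at this
    obtain ⟨φ, hφ⟩ := this
    exact hb φ hφ

/-! ### Extremal points of a piece of a surface are on its silhouette -/

theorem inner_projAlong (d : sphere (0 : E3) 1) {m : E3} (hm : inner ℝ m (d : E3) = 0) (x : E3) :
    inner ℝ m (projAlong d x) = inner ℝ m x := by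
  simp [projAlong, inner_sub_right, inner_smul_right, hm]

theorem projAlong_add_smul (d : sphere (0 : E3) 1) (x : E3) (τ : ℝ) :
    projAlong d (x + τ • (d : E3)) = projAlong d x := by
  have hd : inner ℝ (d : E3) (d : E3) = 1 := by
    rw [real_inner_self_eq_norm_sq, norm_eq_of_mem_sphere]; norm_num
  simp only [projAlong, inner_add_right, inner_smul_right, hd, mul_one, add_smul]
  abel

/-- If a compact connected subset of a line lies in an open set, so does a slightly larger open
segment. -/
theorem exists_openSegment_of_compact {K O : Set E3} {p v : E3} (hv : v ≠ 0) (hKc : IsCompact K)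
    (hKconn : IsPreconnected K) (hKne : K.Nonempty) (hKl : ∀ y ∈ K, ∃ τ : ℝ, y = p + τ • v)
    (hO : IsOpen O) (hKO : K ⊆ O) :
    ∃ τ₁ τ₂ : ℝ, τ₁ < τ₂ ∧ K ⊆ openSegment ℝ (p + τ₁ • v) (p + τ₂ • v) ∧
      openSegment ℝ (p + τ₁ • v) (p + τ₂ • v) ⊆ O := by
  let g : E3 → ℝ := fun y => inner ℝ v (y - p) / inner ℝ v v
  have hvv : (inner ℝ v v : ℝ) ≠ 0 := inner_self_ne_zero.2 hv
  have hg : Continuous g := by fun_prop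
  have hgl : ∀ τ : ℝ, g (p + τ • v) = τ := fun τ => by
    simp only [g, add_sub_cancel_left, inner_smul_right, mul_div_assoc, div_self hvv, mul_one]
  have hgK : ∀ y ∈ K, p + g y • v = y := by
    rintro y hy
    obtain ⟨τ, rfl⟩ := hKl y hy
    rw [hgl]
  have hI : IsCompact (g '' K) := hKc.image hg
  have hIc : IsPreconnected (g '' K) := hKconn.image g hg.continuousOn
  obtain ⟨k₁, hk₁, hmin⟩ := hKc.exists_isMinOn hKne hg.continuousOn
  obtain ⟨k₂, hk₂, hmax⟩ := hKc.exists_isMaxOn hKne hg.continuousOn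
  have hO' : IsOpen ((fun τ : ℝ => p + τ • v) ⁻¹' O) := hO.preimage (by fun_prop)
  have hI_sub : g '' K ⊆ (fun τ : ℝ => p + τ • v) ⁻¹' O := by
    rintro _ ⟨y, hy, rfl⟩
    change p + g y • v ∈ O
    rw [hgK y hy]
    exact hKO hy
  obtain ⟨δ, hδ, hthick⟩ := hI.exists_thickening_subset_open hO' hI_sub
  have hle : g k₁ ≤ g k₂ := hmin hk₂
  have hseg : openSegment ℝ (p + (g k₁ - δ) • v) (p + (g k₂ + δ) • v) =
      (fun τ : ℝ => p + τ • v) '' Ioo (g k₁ - δ) (g k₂ + δ) := by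
    rw [← openSegment_eq_Ioo (by linarith)]
    have h1 : ⇑(AffineMap.lineMap p (p + v) : ℝ →ᵃ[ℝ] E3) = fun τ : ℝ => p + τ • v := by
      funext τ
      simp [AffineMap.lineMap_apply, add_comm]
    have h2 := image_openSegment ℝ (AffineMap.lineMap p (p + v) : ℝ →ᵃ[ℝ] E3)
      (g k₁ - δ) (g k₂ + δ)
    rw [h1] at h2
    exact h2.symm
  refine ⟨g k₁ - δ, g k₂ + δ, by linarith, ?_, ?_⟩
  · intro y hy
    rw [hseg]
    have h1 : g k₁ ≤ g y := hmin hy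
    have h2 : g y ≤ g k₂ := hmax hy
    exact ⟨g y, ⟨by linarith, by linarith⟩, hgK y hy⟩
  · rw [hseg]
    rintro _ ⟨τ, ⟨h1, h2⟩, rfl⟩
    apply hthick
    rw [mem_thickening_iff]
    rcases lt_or_ge τ (g k₁) with h | h
    · exact ⟨g k₁, mem_image_of_mem g hk₁, by rw [Real.dist_eq, abs_lt]; constructor <;> linarith⟩
    rcases lt_or_ge (g k₂) τ with h' | h'
    · exact ⟨g k₂, mem_image_of_mem g hk₂, by rw [Real.dist_eq, abs_lt]; constructor <;> linarith⟩
    · exact ⟨τ, hIc.Icc_subset (mem_image_of_mem g hk₁) (mem_image_of_mem g hk₂) ⟨h, h'⟩, by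
        simpa using hδ⟩

/-- Let the piece `N` of the compact set `S` contain the open piece `U`, let `p` be a point
of `N` that is extremal in the direction `ν` in the slice of `N` parallel to `ν` and to the direction
of view `d`, and let all such extremal points be in `U`.  Then some point of `U` on the line of view
through `p` is on the silhouette. -/
theorem exists_mem_silhouetteSet {S N U O : Set E3} (hS : IsCompact S) (hN : IsClosed N)
    (hUN : U ⊆ N) (hO : IsOpen O) (hOU : S ∩ O = U) (d : sphere (0 : E3) 1) {m ν : E3}
    (hmd : inner ℝ m (d : E3) = 0) (hmν : inner ℝ m ν = 0) (hνd : inner ℝ ν (d : E3) = 0)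
    (hν : ν ≠ 0) {p : E3} (hpN : p ∈ N) (hpS : p ∈ S)
    (hmax : ∀ x ∈ N, inner ℝ m x = inner ℝ m p → inner ℝ ν x ≤ inner ℝ ν p)
    (hU : ∀ x ∈ N, inner ℝ m x = inner ℝ m p → inner ℝ ν x = inner ℝ ν p → x ∈ U) :
    ∃ p' ∈ U, p' ∈ silhouetteSet S (.atInfinity d) ∧ projAlong d p' = projAlong d p := by
  have hd0 : (d : E3) ≠ 0 := by
    intro h
    have := norm_eq_of_mem_sphere d
    rw [h, norm_zero] at this
    exact zero_ne_one this
  set R : Set E3 := {y | ∃ t : ℝ, y = p + t • (d : E3)} with hR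
  have hRclosed : IsClosed R := by
    have h1 : R = {y | p + inner ℝ (d : E3) (y - p) • (d : E3) = y} := by
      ext y
      constructor
      · rintro ⟨t, rfl⟩
        simp [inner_smul_right]
      · intro h
        exact ⟨_, h.symm⟩
    rw [h1]
    exact isClosed_eq (by fun_prop) continuous_id
  have hRm : ∀ y ∈ R, inner ℝ m y = inner ℝ m p := by
    rintro y ⟨t, rfl⟩
    simp [inner_add_right, inner_smul_right, hmd]
  have hRν : ∀ y ∈ R, inner ℝ ν y = inner ℝ ν p := by
    rintro y ⟨t, rfl⟩
    simp [inner_add_right, inner_smul_right, hνd]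
  have hRproj : ∀ y ∈ R, projAlong d y = projAlong d p := by
    rintro y ⟨t, rfl⟩
    exact projAlong_add_smul d p t
  have hray : ∀ y ∈ R, (Viewpoint.atInfinity d).ray y = R := by
    rintro y ⟨t, rfl⟩
    ext z
    constructor
    · rintro ⟨s, rfl⟩
      exact ⟨t + s, by rw [add_smul, add_assoc]⟩
    · rintro ⟨s, rfl⟩
      exact ⟨s - t, by rw [sub_smul]; abel⟩
  have hpR : p ∈ R := ⟨0, by simp⟩
  set K : Set E3 := connectedComponentIn (R ∩ S) p with hKdef
  have hpK : p ∈ K := mem_connectedComponentIn ⟨hpR, hpS⟩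
  have hKsub : K ⊆ R ∩ S := connectedComponentIn_subset _ _
  have hKconn : IsPreconnected K := isPreconnected_connectedComponentIn
  have hFc : IsCompact (R ∩ S) := hS.inter_left hRclosed
  have hKcomp : IsCompact K := by
    have : K = closure K := by
      apply subset_antisymm subset_closure
      exact hKconn.closure.subset_connectedComponentIn (subset_closure hpK)
        (closure_minimal hKsub hFc.isClosed)
    exact hFc.of_isClosed_subset (by rw [this]; exact isClosed_closure) hKsub
  -- Points of `K` in `N` have the same extremal coordinates as `p`, so they lie in `U`. Thus `O`
  -- and the complement of `N` separate `K`, and connectedness leaves only `O`, because `p` is in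
  -- `N`.
  have hKU : K ⊆ U := by
    have h1 : K ⊆ O ∪ Nᶜ := by
      intro y hy
      by_cases hyN : y ∈ N
      · left
        have : y ∈ U := hU y hyN (hRm y (hKsub hy).1) (hRν y (hKsub hy).1)
        rw [← hOU] at this
        exact this.2
      · exact Or.inr hyN
    have h2 : K ∩ (O ∩ Nᶜ) = ∅ := by
      ext y
      simp only [mem_inter_iff, mem_empty_iff_false, iff_false, not_and]
      intro hy hyO hyN
      exact hyN (hUN (hOU ▸ ⟨(hKsub hy).2, hyO⟩))
    rcases isPreconnected_iff_subset_of_disjoint.1 hKconn O Nᶜ hO hN.isOpen_compl h1 h2 with h | h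
    · intro y hy
      rw [← hOU]
      exact ⟨(hKsub hy).2, h hy⟩
    · exact absurd hpN (h hpK)
  by_cases hb : (K ∩ surfaceBoundary S).Nonempty
  · obtain ⟨y, hyK, hyb⟩ := hb
    exact ⟨y, hKU hyK, Or.inr hyb, hRproj y (hKsub hyK).1⟩
  obtain ⟨p', hp'K, hp'min⟩ := hKcomp.exists_isMinOn ⟨p, hpK⟩
    (f := (Viewpoint.atInfinity d).depth) (by
      change ContinuousOn (fun y : E3 => - inner ℝ (d : E3) y) K
      fun_prop)
  refine ⟨p', hKU hp'K, Or.inl ⟨(hKsub hp'K).2, ?_⟩, hRproj p' (hKsub hp'K).1⟩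
  rw [hray p' (hKsub hp'K).1, ← connectedComponentIn_eq hp'K]
  refine ⟨?_, fun q hq => hp'min hq⟩
  -- a segment around `K` that avoids the boundary and the rest of `S`
  obtain ⟨O₂, hO₂, hO₂eq⟩ := exists_open_inter_surfaceBoundary S
  have hKO : K ⊆ O ∩ O₂ := by
    intro y hy
    have h1 : y ∈ S ∩ O := hOU.symm ▸ hKU hy
    have h2 : y ∈ S ∩ O₂ := by
      rw [← hO₂eq]
      exact ⟨h1.1, fun h => hb ⟨y, hy, h⟩⟩
    exact ⟨h1.2, h2.2⟩
  obtain ⟨τ₁, τ₂, hτ, hKu, huO⟩ := exists_openSegment_of_compact hd0 hKcomp hKconn ⟨p, hpK⟩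
    (fun y hy => (hKsub hy).1) (hO.inter hO₂) hKO
  have hRconv : Convex ℝ R := by
    have : R = (AffineMap.lineMap p (p + (d : E3)) : ℝ →ᵃ[ℝ] E3) '' univ := by
      ext y
      simp [hR, AffineMap.lineMap_apply, add_comm, eq_comm]
    rw [this]
    exact convex_univ.affine_image _
  have huR : openSegment ℝ (p + τ₁ • (d : E3)) (p + τ₂ • (d : E3)) ⊆ R :=
    hRconv.openSegment_subset ⟨τ₁, rfl⟩ ⟨τ₂, rfl⟩
  refine ⟨_, ⟨τ₁, rfl⟩, _, ⟨τ₂, rfl⟩, ?_, huR, hKu, ?_, ?_⟩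
  · intro h
    rw [add_right_inj, ← sub_eq_zero, ← sub_smul, smul_eq_zero] at h
    rcases h with h | h
    · linarith
    · exact hd0 h
  · rw [disjoint_left]
    intro y hyu hyb
    have hyS : y ∈ S := hyb.1
    have : y ∈ S \ surfaceBoundary S := by
      rw [hO₂eq]; exact ⟨hyS, (huO hyu).2⟩
    exact this.2 hyb
  intro W hW huW
  set u := openSegment ℝ (p + τ₁ • (d : E3)) (p + τ₂ • (d : E3)) with hu
  -- The connected set off `S` will be a thin sheet that grows from `u` in direction `ν`, with its
  -- width at `y` bounded by the distance from `y` to `Z`. The sheet misses `S`, since a point of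
  -- `S` in it would be in `U ⊆ N` and beat the maximum of `ν`. The extra point `p + ν`, which is
  -- not on the line of sight, keeps `Z` nonempty: `infDist` to the empty set would be 0.
  set Z : Set E3 := (W ∩ O)ᶜ ∪ {p + ν} with hZ
  have hZc : IsClosed Z := (hW.inter hO).isClosed_compl.union isClosed_singleton
  have hZne : Z.Nonempty := ⟨p + ν, Or.inr rfl⟩
  have hρ : ∀ y ∈ u, 0 < infDist y Z := by
    intro y hy
    rw [← hZc.notMem_iff_infDist_pos hZne]
    rintro (h | h)
    · exact h ⟨huW hy, (huO hy).1⟩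
    · have h1 := hRν y (huR hy)
      rw [h, inner_add_right, add_eq_left, inner_self_eq_zero] at h1
      exact hν h1
  have hνn : 0 < ‖ν‖ := norm_pos_iff.2 hν
  let F : E3 × ℝ → E3 := fun q => q.1 + (q.2 * infDist q.1 Z / ‖ν‖) • ν
  have hF : Continuous F := by
    have : Continuous fun q : E3 × ℝ => infDist q.1 Z :=
      (continuous_infDist_pt Z).comp continuous_fst
    fun_prop
  refine ⟨F '' (u ×ˢ Ioo 0 1), ?_, ?_, ?_⟩
  · exact (((convex_openSegment _ _).prod (convex_Ioo 0 1)).isPreconnected).image F hF.continuousOn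
  · rintro _ ⟨⟨y, l⟩, ⟨hy, hl⟩, rfl⟩
    simp only at hy hl
    have hpos := hρ y hy
    have hFO : F (y, l) ∈ W ∩ O := by
      by_contra hcon
      have h1 : F (y, l) ∈ Z := Or.inl hcon
      have h2 := infDist_le_dist_of_mem (x := y) h1
      have h3 : dist y (F (y, l)) = l * infDist y Z := by
        simp only [F, dist_self_add_right, norm_smul, norm_div, norm_mul, norm_norm]
        rw [div_mul_cancel₀ _ hνn.ne', Real.norm_of_nonneg hl.1.le, Real.norm_of_nonneg hpos.le]
      rw [h3] at h2
      nlinarith [hl.2]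
    refine ⟨hFO.1, fun hFS => ?_⟩
    have hFN : F (y, l) ∈ N := hUN (hOU ▸ ⟨hFS, hFO.2⟩)
    have h1 := hmax _ hFN (by
      simp only [F, inner_add_right, inner_smul_right, hmν, mul_zero, add_zero]
      exact hRm y (huR hy))
    simp only [F, inner_add_right, inner_smul_right, hRν y (huR hy)] at h1
    have h2 : 0 < l * infDist y Z / ‖ν‖ * inner ℝ ν ν :=
      mul_pos (div_pos (mul_pos hl.1 hpos) hνn) (real_inner_self_pos.2 hν)
    linarith
  · intro y hy
    have h1 : Filter.Tendsto (fun l : ℝ => F (y, l)) (nhdsWithin 0 (Ioi 0)) (nhds (F (y, 0))) :=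
      ((hF.comp (Continuous.prodMk_right y)).tendsto 0).mono_left nhdsWithin_le_nhds
    have h2 : F (y, 0) = y := by simp [F]
    rw [h2] at h1
    refine mem_closure_of_tendsto h1 ?_
    filter_upwards [Ioo_mem_nhdsGT (zero_lt_one (α := ℝ))] with l hl
    exact ⟨(y, l), ⟨hy, hl⟩, rfl⟩

/-! ### The length of the piece of the silhouette in a family of slices -/

/-- The points of `Q` in the slices `t ∈ I` that are extremal with respect to `s` in their slice. -/
def extremalPoints (Q : Set E3) (t s : E3 → ℝ) (I : Set ℝ) : Set E3 :=
  {y ∈ Q | t y ∈ I ∧ ∀ x ∈ Q, t x = t y → s x ≤ s y}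

/-- A point fails to be extremal if and only if some point of its slice beats it by at least 1/(k+1)
for some k. For fixed k these points form the projection of a compact set. -/
theorem measurableSet_extremalPoints {Q : Set E3} (hQ : IsCompact Q) {t s : E3 → ℝ}
    (ht : Continuous t) (hs : Continuous s) {I : Set ℝ} (hI : MeasurableSet I) :
    MeasurableSet (extremalPoints Q t s I) := by
  have h1 : extremalPoints Q t s I = (Q ∩ t ⁻¹' I) \
      ⋃ k : ℕ, Prod.fst '' ((Q ×ˢ Q) ∩ {q : E3 × E3 | t q.2 = t q.1 ∧
        s q.1 + 1 / ((k : ℝ) + 1) ≤ s q.2}) := by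
    ext y
    constructor
    · rintro ⟨hy, hyI, hmax⟩
      refine ⟨⟨hy, hyI⟩, fun hcon => ?_⟩
      obtain ⟨k, ⟨⟨y', x⟩, ⟨⟨-, hx⟩, htx, hsx⟩, rfl⟩⟩ := mem_iUnion.1 hcon
      have h2 := hmax x hx htx
      have h3 : (0 : ℝ) < 1 / ((k : ℝ) + 1) := Nat.one_div_pos_of_nat
      simp only at hsx h2
      linarith
    · rintro ⟨⟨hy, hyI⟩, hn⟩
      refine ⟨hy, hyI, fun x hx htx => ?_⟩
      by_contra! hlt
      obtain ⟨k, hk⟩ := exists_nat_one_div_lt (sub_pos.2 hlt)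
      exact hn (mem_iUnion.2 ⟨k, (y, x), ⟨⟨hy, hx⟩, htx, by simp only; linarith⟩, rfl⟩)
  rw [h1]
  refine (hQ.measurableSet.inter (ht.measurable hI)).diff (MeasurableSet.iUnion fun k => ?_)
  refine (((hQ.prod hQ).inter_right ?_).image continuous_fst).measurableSet
  exact (isClosed_eq (ht.comp continuous_snd) (ht.comp continuous_fst)).inter
    (isClosed_le ((hs.comp continuous_fst).add continuous_const) (hs.comp continuous_snd))

/-- By compactness every nonempty slice has an extremal point, so `t` maps the extremal points onto
a superset of `I`, and a 1-Lipschitz map does not increase length. -/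
theorem volume_le_hausdorffMeasure_extremalPoints {Q : Set E3} (hQ : IsCompact Q) {t s : E3 → ℝ}
    (ht : LipschitzWith 1 t) (hs : Continuous s) {I : Set ℝ} (hI : I ⊆ t '' Q) :
    volume I ≤ (Measure.hausdorffMeasure 1 : Measure E3) (extremalPoints Q t s I) := by
  have h1 : I ⊆ t '' extremalPoints Q t s I := by
    intro τ hτ
    obtain ⟨x, hx, hxτ⟩ := hI hτ
    have hc : IsCompact (Q ∩ t ⁻¹' {τ}) := hQ.inter_right (isClosed_singleton.preimage ht.continuous)
    obtain ⟨y, ⟨hyQ, hyτ⟩, hy⟩ := hc.exists_isMaxOn ⟨x, hx, hxτ⟩ hs.continuousOn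
    have hyτ' : t y = τ := hyτ
    exact ⟨y, ⟨hyQ, hyτ'.symm ▸ hτ, fun z hz hzt => hy ⟨hz, hzt.trans hyτ'⟩⟩, hyτ'⟩
  calc volume I ≤ volume (t '' extremalPoints Q t s I) := measure_mono h1
    _ = (Measure.hausdorffMeasure 1 : Measure ℝ) (t '' extremalPoints Q t s I) := by
        rw [hausdorffMeasure_real]
    _ ≤ _ := by
        have := ht.hausdorffMeasure_image_le zero_le_one (extremalPoints Q t s I)
        simpa using this

/-! ### Cross products, normals and heights of triangles -/

theorem inner_eq_three (x y : E3) : inner ℝ x y = x 0 * y 0 + x 1 * y 1 + x 2 * y 2 := by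
  simp only [PiLp.inner_apply, Fin.sum_univ_three, RCLike.inner_apply, conj_trivial]
  ring

theorem cross_zero (u v : E3) : cross u v 0 = u 1 * v 2 - u 2 * v 1 := by
  simp [cross, crossProduct]

theorem cross_one (u v : E3) : cross u v 1 = u 2 * v 0 - u 0 * v 2 := by
  simp [cross, crossProduct]

theorem cross_two (u v : E3) : cross u v 2 = u 0 * v 1 - u 1 * v 0 := by
  simp [cross, crossProduct]

theorem inner_cross_left (u v : E3) : inner ℝ (cross u v) u = 0 := by
  rw [inner_eq_three, cross_zero, cross_one, cross_two]; ring

theorem inner_cross_right (u v : E3) : inner ℝ (cross u v) v = 0 := by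
  rw [inner_eq_three, cross_zero, cross_one, cross_two]; ring

theorem inner_cross_cyclic (u v w : E3) : inner ℝ (cross u v) w = inner ℝ (cross w u) v := by
  simp only [inner_eq_three, cross_zero, cross_one, cross_two]; ring

theorem norm_cross_sq (u v : E3) :
    ‖cross u v‖ ^ 2 = ‖u‖ ^ 2 * ‖v‖ ^ 2 - inner ℝ u v ^ 2 := by
  simp only [← real_inner_self_eq_norm_sq, inner_eq_three, cross_zero, cross_one, cross_two]; ring

theorem triNormal_swap (a b c : E3) : triNormal b a c = - triNormal a b c := by
  ext i
  fin_cases i <;>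
    simp [triNormal, cross_zero, cross_one, cross_two] <;> ring

theorem inner_triNormal_edge (a b c : E3) : inner ℝ (triNormal a b c) (b - a) = 0 :=
  inner_cross_left _ _

/-- Height times base equals the area of the parallelogram. -/
theorem norm_sub_smul_mul_norm (u v : E3) (hv : v ≠ 0) :
    ‖u - (inner ℝ v u / ‖v‖ ^ 2) • v‖ * ‖v‖ = ‖cross u v‖ := by
  have hv' : ‖v‖ ≠ 0 := norm_ne_zero_iff.2 hv
  rw [← sq_eq_sq₀ (by positivity) (by positivity), norm_cross_sq, mul_pow, norm_sub_sq_real,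
    norm_smul, inner_smul_right, mul_pow, Real.norm_eq_abs, sq_abs, real_inner_comm u v]
  field_simp
  ring

open Classical in
theorem minHeight_le_of_mem {T : Finset E3} {v y : E3} (hv : v ∈ T)
    (hy : y ∈ affineSpan ℝ ((T : Set E3) \ {v})) : minHeight T ≤ dist v y := by
  refine (ciInf_le ⟨0, ?_⟩ (⟨v, hv⟩ : T)).trans (infDist_le_dist_of_mem hy)
  rintro _ ⟨w, rfl⟩
  exact infDist_nonneg

theorem minHeight_nonneg (T : Finset E3) : 0 ≤ minHeight T :=
  Real.iInf_nonneg fun _ => infDist_nonneg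

theorem minHeight_le_dist {T : Finset E3} {v w : E3} (hv : v ∈ T) (hw : w ∈ T) (hvw : v ≠ w) :
    minHeight T ≤ dist v w :=
  minHeight_le_of_mem hv (subset_affineSpan ℝ _ ⟨hw, fun h => hvw (by simpa using h.symm)⟩)

theorem minHeight_mul_le {T : Finset E3} {a b c : E3} (ha : a ∈ T) (hb : b ∈ T) (hc : c ∈ T)
    (hab : a ≠ b) (hac : a ≠ c) (hbc : b ≠ c) :
    minHeight T * ‖c - a‖ ≤ ‖triNormal a b c‖ := by
  have hv : c - a ≠ 0 := sub_ne_zero.2 hac.symm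
  have h1 := norm_sub_smul_mul_norm (b - a) (c - a) hv
  rw [triNormal, ← h1]
  gcongr
  set l := inner ℝ (c - a) (b - a) / ‖c - a‖ ^ 2
  have h2 : b - a - l • (c - a) = b - AffineMap.lineMap a c l := by
    simp [AffineMap.lineMap_apply]; abel
  rw [h2, ← dist_eq_norm]
  refine minHeight_le_of_mem hb (affineSpan_mono ℝ ?_ (AffineMap.lineMap_mem_affineSpan_pair l a c))
  rintro x (rfl | rfl)
  · exact ⟨ha, hab⟩
  · exact ⟨hc, hbc.symm⟩

/-! ### The extension of a map defined on a subset of space -/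

open Classical in
/-- The extension of `f : P ≃ₜ S` to all of space by the identity. -/
noncomputable def extendMap {P S : Set E3} (f : P ≃ₜ S) (x : E3) : E3 :=
  if h : x ∈ P then (f ⟨x, h⟩ : E3) else x

section extendMap

variable {P S : Set E3} (f : P ≃ₜ S)

theorem extendMap_apply (x : P) : extendMap f x = f x := by
  simp [extendMap]

theorem extendMap_of_mem {x : E3} (hx : x ∈ P) : extendMap f x = f ⟨x, hx⟩ := by
  simp [extendMap, hx]

theorem continuousOn_extendMap : ContinuousOn (extendMap f) P := by
  rw [continuousOn_iff_continuous_domRestrict]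
  have : P.domRestrict (extendMap f) = fun x => (f x : E3) := by
    funext x
    exact extendMap_apply f x
  rw [this]
  exact continuous_subtype_val.comp f.continuous

theorem injOn_extendMap : InjOn (extendMap f) P := by
  intro x hx y hy h
  rw [extendMap_of_mem f hx, extendMap_of_mem f hy] at h
  exact congrArg Subtype.val (f.injective (Subtype.ext h))

theorem extendMap_mem {x : E3} (hx : x ∈ P) : extendMap f x ∈ S := by
  rw [extendMap_of_mem f hx]
  exact (f _).2

theorem exists_open_image_extendMap {O : Set E3} (hO : IsOpen O) :
    ∃ O' : Set E3, IsOpen O' ∧ S ∩ O' = extendMap f '' (P ∩ O) := by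
  have h : IsOpen (f.symm ⁻¹' (Subtype.val ⁻¹' O)) :=
    (hO.preimage continuous_subtype_val).preimage f.symm.continuous
  obtain ⟨O', hO', h'⟩ := isOpen_induced_iff.1 h
  refine ⟨O', hO', ?_⟩
  ext y
  constructor
  · rintro ⟨hyS, hyO⟩
    have h1 : (⟨y, hyS⟩ : S) ∈ (Subtype.val ⁻¹' O' : Set S) := hyO
    rw [h'] at h1
    exact ⟨f.symm ⟨y, hyS⟩, ⟨(f.symm ⟨y, hyS⟩).2, h1⟩, by rw [extendMap_apply]; simp⟩
  · rintro ⟨x, ⟨hxP, hxO⟩, rfl⟩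
    refine ⟨extendMap_mem f hxP, ?_⟩
    have h1 : f ⟨x, hxP⟩ ∈ f.symm ⁻¹' (Subtype.val ⁻¹' O) := by simpa using hxO
    rw [← h'] at h1
    rw [extendMap_of_mem f hxP]
    exact h1

end extendMap

/-! ### A surface close to two triangles that are seen on the same side of their common edge -/

/-- If `y` is at least L/3 along the edge, then `x` has travelled a distance of at least L/3 - ε ≥
L/4 from `a` on its side of the triangle. By then that side has dropped by at least 3ε in direction
`ν`, and the perturbation recovers less than ε. -/
theorem inner_lt_of_near_segment {a c x y m ν : E3} {ε σ L : ℝ} (hm : ‖m‖ = 1) (hν : ‖ν‖ = 1)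
    (hc : inner ℝ ν (c - a) = -σ) (hL : 0 < L) (hε : 0 < ε) (h1 : 12 * ε * ‖c - a‖ ≤ σ * L)
    (h2 : 12 * ε ≤ L) (hx : x ∈ segment ℝ a c) (hxy : dist x y < ε)
    (hy : L / 3 ≤ inner ℝ m (y - a)) : inner ℝ ν (y - a) < -ε := by
  rw [segment_eq_image'] at hx
  obtain ⟨l, ⟨hl0, hl1⟩, rfl⟩ := hx
  set x := a + l • (c - a) with hx
  have e1 : y - a = (y - x) + l • (c - a) := by rw [hx]; abel
  have e2 : ‖y - x‖ < ε := by rwa [← dist_eq_norm, dist_comm]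
  have b1 : inner ℝ m (y - x) ≤ ‖y - x‖ := by
    simpa [hm] using real_inner_le_norm m (y - x)
  have b2 : inner ℝ ν (y - x) ≤ ‖y - x‖ := by
    simpa [hν] using real_inner_le_norm ν (y - x)
  have b3 : inner ℝ m (c - a) ≤ ‖c - a‖ := by
    simpa [hm] using real_inner_le_norm m (c - a)
  rw [e1, inner_add_right, inner_smul_right] at hy ⊢
  rw [hc]
  have b4 : l * inner ℝ m (c - a) ≤ l * ‖c - a‖ := mul_le_mul_of_nonneg_left b3 hl0
  have b5 : L / 4 ≤ l * ‖c - a‖ := by linarith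
  have b6 : 12 * ε * (L / 4) ≤ 12 * ε * (l * ‖c - a‖) := by gcongr
  have b7 : l * (12 * ε * ‖c - a‖) ≤ l * (σ * L) := mul_le_mul_of_nonneg_left h1 hl0
  have b8 : 3 * ε * L ≤ l * σ * L := by nlinarith
  have b9 : 3 * ε ≤ l * σ := le_of_mul_le_mul_right b8 hL
  linarith

/-- In view coordinates, `m` runs along the projected edge and `ν` points away from both triangles.
In a slice of the middle third, the image of the edge stays above level -ε relative to the edge,
while the images of the other sides are below it. So the top of the slice comes from the open star
`O`. -/
theorem exists_extremal_silhouette {P S : Set E3} (f : P ≃ₜ S) (hS : IsCompact S)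
    (d : sphere (0 : E3) 1) {m ν : E3} (hm : ‖m‖ = 1) (hν : ‖ν‖ = 1)
    (hmd : inner ℝ m (d : E3) = 0) (hmν : inner ℝ m ν = 0) (hνd : inner ℝ ν (d : E3) = 0)
    {a b : E3} {L : ℝ} (hL : 0 < L) (hmab : inner ℝ m (b - a) = L) (hνab : inner ℝ ν (b - a) = 0)
    {c : Fin 2 → E3} {ε σ : Fin 2 → ℝ} (hε : ∀ i, 0 < ε i)
    (hc : ∀ i, inner ℝ ν (c i - a) = -σ i)
    (h1 : ∀ i, 12 * ε i * ‖c i - a‖ ≤ σ i * L) (h2 : ∀ i, 12 * ε i * ‖c i - b‖ ≤ σ i * L)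
    (h3 : ∀ i, 12 * ε i ≤ L) {O : Set E3} (hO : IsOpen O)
    (hTP : ∀ i, convexHull ℝ {a, b, c i} ⊆ P)
    (hdist : ∀ i, ∀ x ∈ convexHull ℝ {a, b, c i}, dist x (extendMap f x) < ε i)
    (hOT : P ∩ O ⊆ ⋃ i, convexHull ℝ {a, b, c i})
    (hTO : ∀ i, convexHull ℝ {a, b, c i} ⊆ O ∪ (segment ℝ a (c i) ∪ segment ℝ b (c i))) :
    ∃ G : Set E3, MeasurableSet G ∧
      ENNReal.ofReal (L / 3) ≤ (Measure.hausdorffMeasure 1 : Measure E3) G ∧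
      ∀ y ∈ G, ∃ p ∈ extendMap f '' (P ∩ O), p ∈ silhouetteSet S (.atInfinity d) ∧
        projAlong d p = y := by
  set F := extendMap f with hF
  set T : Set E3 := ⋃ i, convexHull ℝ {a, b, c i} with hT
  have hTc : IsCompact T := isCompact_iUnion fun i => (Set.toFinite _).isCompact_convexHull ℝ
  have hTP' : T ⊆ P := iUnion_subset hTP
  have hN : IsCompact (F '' T) := hTc.image_of_continuousOn ((continuousOn_extendMap f).mono hTP')
  have hprojc : Continuous (projAlong d) := by
    unfold projAlong; fun_prop
  have hQ : IsCompact (projAlong d '' (F '' T)) := hN.image hprojc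
  have hseg : ∀ i, segment ℝ a b ⊆ convexHull ℝ {a, b, c i} := fun i =>
    segment_subset_convexHull (by simp) (by simp)
  have hsegT : segment ℝ a b ⊆ T := (hseg 0).trans (subset_iUnion (fun i => convexHull ℝ {a, b, c i}) 0)
  have htl : LipschitzWith 1 (fun y : E3 => (inner ℝ m y : ℝ)) := by
    refine LipschitzWith.of_dist_le_mul fun x y => ?_
    rw [Real.dist_eq, ← inner_sub_right, dist_eq_norm]
    simpa [hm] using abs_real_inner_le_norm m (x - y)
  have hsc : Continuous (fun y : E3 => (inner ℝ ν y : ℝ)) := by fun_prop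
  set I : Set ℝ := Icc (inner ℝ m a + L / 3) (inner ℝ m a + 2 * L / 3) with hI
  -- the image of the edge meets all slices
  have hmeet : ∀ τ ∈ I, ∃ x ∈ segment ℝ a b, inner ℝ m (F x) = τ := by
    intro τ hτ
    have hcont : ContinuousOn (fun x => (inner ℝ m (F x) : ℝ)) (segment ℝ a b) :=
      htl.continuous.comp_continuousOn ((continuousOn_extendMap f).mono (hsegT.trans hTP'))
    have hends := (convex_segment a b).isPreconnected.intermediate_value
      (left_mem_segment ℝ a b) (right_mem_segment ℝ a b) hcont
    have ha := hdist 0 a (hseg 0 (left_mem_segment ℝ a b))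
    have hb := hdist 0 b (hseg 0 (right_mem_segment ℝ a b))
    rw [dist_comm, dist_eq_norm] at ha
    rw [dist_eq_norm] at hb
    have ha' : inner ℝ m (F a - a) ≤ ‖F a - a‖ := by
      simpa [hm] using real_inner_le_norm m (F a - a)
    have hb' : inner ℝ m (b - F b) ≤ ‖b - F b‖ := by
      simpa [hm] using real_inner_le_norm m (b - F b)
    rw [inner_sub_right] at ha' hb' hmab
    have := h3 0
    have hmem : τ ∈ Icc (inner ℝ m (F a)) (inner ℝ m (F b)) :=
      ⟨by linarith [hτ.1], by linarith [hτ.2]⟩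
    obtain ⟨x, hx, hxe⟩ := hends hmem
    exact ⟨x, hx, hxe⟩
  refine ⟨extremalPoints (projAlong d '' (F '' T)) (fun y => inner ℝ m y) (fun y => inner ℝ ν y) I,
    measurableSet_extremalPoints hQ htl.continuous hsc measurableSet_Icc, ?_, ?_⟩
  · have hvol : volume I = ENNReal.ofReal (L / 3) := by
      rw [hI, Real.volume_Icc]; congr 1; ring
    rw [← hvol]
    apply volume_le_hausdorffMeasure_extremalPoints hQ htl hsc
    intro τ hτ
    obtain ⟨x, hx, hxe⟩ := hmeet τ hτ
    exact ⟨projAlong d (F x), mem_image_of_mem _ (mem_image_of_mem _ (hsegT hx)), by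
      simp only [inner_projAlong d hmd, hxe]⟩
  rintro _ ⟨⟨p, hpN, rfl⟩, hpI, hmax⟩
  simp only [inner_projAlong d hmd, inner_projAlong d hνd] at hpI hmax
  have hmax' : ∀ x ∈ F '' T, inner ℝ m x = inner ℝ m p → inner ℝ ν x ≤ inner ℝ ν p := by
    intro x hx hxm
    have := hmax (projAlong d x) (mem_image_of_mem _ hx)
    simp only [inner_projAlong d hmd, inner_projAlong d hνd] at this
    exact this hxm
  obtain ⟨O', hO', hOU'⟩ := exists_open_image_extendMap f hO
  have hUN : F '' (P ∩ O) ⊆ F '' T := image_mono hOT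
  have hpS : p ∈ S := by
    obtain ⟨x, hx, rfl⟩ := hpN
    exact extendMap_mem f (hTP' hx)
  refine exists_mem_silhouetteSet hS hN.isClosed hUN hO' hOU' d hmd hmν hνd
    (norm_ne_zero_iff.1 (by rw [hν]; exact one_ne_zero)) hpN hpS hmax' ?_
  rintro _ ⟨z, hz, rfl⟩ hzm hzν
  by_contra hzU
  obtain ⟨i, hzi⟩ := mem_iUnion.1 hz
  have hzO : z ∉ O := fun h => hzU ⟨z, ⟨hTP i hzi, h⟩, rfl⟩
  have hzd := hdist i z hzi
  rw [← hzm] at hpI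
  have key : inner ℝ ν (F z - a) < -ε i := by
    rcases hTO i hzi with h | h | h
    · exact absurd h hzO
    · refine inner_lt_of_near_segment hm hν (hc i) hL (hε i) (h1 i) (h3 i) h hzd ?_
      rw [inner_sub_right]
      linarith [hpI.1]
    -- The side at `b` is the mirror image: reverse `m` and measure from `b`, so that the bound 2L/3
    -- on the slice takes the role of L/3.
    · have := inner_lt_of_near_segment (m := -m) (ν := ν) (a := b) (c := c i) (σ := σ i)
        (by rwa [norm_neg]) hν
        (by rw [← sub_sub_sub_cancel_right (c i) b a, inner_sub_right, hνab, hc, sub_zero])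
        hL (hε i) (h2 i) (h3 i) h hzd (by
          rw [inner_neg_left, inner_sub_right]
          rw [inner_sub_right] at hmab
          linarith [hpI.2])
      rw [inner_sub_right] at this hνab ⊢
      linarith
  -- Compare with an image point of the edge in the same slice. The edge lies in triangle `i` as
  -- well, so the same `ε i` bounds its displacement.
  obtain ⟨x, hx, hxe⟩ := hmeet _ hpI
  have hx1 := hmax' (F x) (mem_image_of_mem _ (hsegT hx)) (hxe.trans hzm)
  have hx2 := hdist i x (hseg i hx)
  rw [dist_eq_norm] at hx2
  have hx3 : inner ℝ ν (x - F x) ≤ ‖x - F x‖ := by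
    simpa [hν] using real_inner_le_norm ν (x - F x)
  have hx4 : inner ℝ ν (x - a) = 0 := by
    rw [segment_eq_image'] at hx
    obtain ⟨l, -, rfl⟩ := hx
    rw [add_sub_cancel_left, inner_smul_right, hνab, mul_zero]
  rw [inner_sub_right] at hx3 hx4 key
  linarith

/-! ### Apparent length of an edge and its angle with the direction of view -/

theorem norm_projAlong_sq (d : sphere (0 : E3) 1) (u : E3) :
    ‖projAlong d u‖ ^ 2 = ‖u‖ ^ 2 - inner ℝ (d : E3) u ^ 2 := by
  have hd : ‖(d : E3)‖ = 1 := norm_eq_of_mem_sphere d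
  rw [projAlong, norm_sub_sq_real, norm_smul, inner_smul_right, real_inner_comm, hd, mul_one,
    Real.norm_eq_abs, sq_abs]
  ring

theorem norm_projAlong_eq_norm_cross (d : sphere (0 : E3) 1) (u : E3) :
    ‖projAlong d u‖ = ‖cross d u‖ := by
  have hd : ‖(d : E3)‖ = 1 := norm_eq_of_mem_sphere d
  rw [← sq_eq_sq₀ (norm_nonneg _) (norm_nonneg _), norm_projAlong_sq, norm_cross_sq, hd]
  ring

/-- The distance of `d` from the line spanned by `u` is at least its distance from the plane
orthogonal to `n`, which contains that line. So a direction far from the plane of a triangle sees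
its edges at a good apparent length. -/
theorem norm_mul_abs_inner_le (d : sphere (0 : E3) 1) {u n : E3} (hn : inner ℝ n u = 0) :
    ‖u‖ * |inner ℝ n (d : E3)| ≤ ‖n‖ * ‖projAlong d u‖ := by
  have hd : ‖(d : E3)‖ = 1 := norm_eq_of_mem_sphere d
  rcases eq_or_ne u 0 with rfl | hu
  · simp; positivity
  have hu' : 0 < ‖u‖ := norm_pos_iff.2 hu
  have h1 : inner ℝ n (d : E3) = inner ℝ n ((d : E3) - (inner ℝ u (d : E3) / ‖u‖ ^ 2) • u) := by
    rw [inner_sub_right, inner_smul_right, hn]; ring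
  have h2 := norm_sub_smul_mul_norm (d : E3) u hu
  rw [norm_projAlong_eq_norm_cross, ← h2, h1]
  have := abs_real_inner_le_norm n ((d : E3) - (inner ℝ u (d : E3) / ‖u‖ ^ 2) • u)
  calc _ ≤ ‖u‖ * (‖n‖ * ‖(d : E3) - (inner ℝ u (d : E3) / ‖u‖ ^ 2) • u‖) := by gcongr
    _ = _ := by ring

/-- If `d` is far from the planes of two triangles that are seen from direction `d` on the same side
of their common edge, then the part of the surface near the triangles has a silhouette of
length at least a third of the apparent length of the edge. -/
theorem exists_silhouette_near_edge {P S : Set E3} (f : P ≃ₜ S) (hS : IsCompact S)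
    (d : sphere (0 : E3) 1) {a b : E3} {c : Fin 2 → E3} {ε : Fin 2 → ℝ} {h : Fin 2 → ℝ} {δ : ℝ}
    (hδ : 0 < δ) (hab : a ≠ b) (hε : ∀ i, 0 < ε i) (hεh : ∀ i, 12 * ε i ≤ δ * h i)
    (hh1 : ∀ i, h i * ‖c i - a‖ ≤ ‖triNormal a b (c i)‖)
    (hh2 : ∀ i, h i * ‖c i - b‖ ≤ ‖triNormal a b (c i)‖)
    (hh3 : ∀ i, h i ≤ ‖b - a‖)
    (hn : ∀ i, triNormal a b (c i) ≠ 0)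
    (hd : ∀ i, δ * ‖triNormal a b (c i)‖ ≤ |inner ℝ (triNormal a b (c i)) (d : E3)|)
    (hsign : 0 < inner ℝ (triNormal a b (c 0)) (d : E3) * inner ℝ (triNormal a b (c 1)) (d : E3))
    {O : Set E3} (hO : IsOpen O)
    (hTP : ∀ i, convexHull ℝ {a, b, c i} ⊆ P)
    (hdist : ∀ i, ∀ x ∈ convexHull ℝ {a, b, c i}, dist x (extendMap f x) < ε i)
    (hOT : P ∩ O ⊆ ⋃ i, convexHull ℝ {a, b, c i})
    (hTO : ∀ i, convexHull ℝ {a, b, c i} ⊆ O ∪ (segment ℝ a (c i) ∪ segment ℝ b (c i))) :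
    ∃ G : Set E3, MeasurableSet G ∧
      ENNReal.ofReal (‖projAlong d (b - a)‖ / 3) ≤ (Measure.hausdorffMeasure 1 : Measure E3) G ∧
      ∀ y ∈ G, ∃ p ∈ extendMap f '' (P ∩ O), p ∈ silhouetteSet S (.atInfinity d) ∧
        projAlong d p = y := by
  set L := ‖projAlong d (b - a)‖ with hLdef
  have hd1 : ‖(d : E3)‖ = 1 := norm_eq_of_mem_sphere d
  have hu : 0 < ‖b - a‖ := norm_pos_iff.2 (sub_ne_zero.2 hab.symm)
  have hnn : ∀ i, 0 < ‖triNormal a b (c i)‖ := fun i => norm_pos_iff.2 (hn i)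
  have hLu : δ * ‖b - a‖ ≤ L := by
    have h1 := norm_mul_abs_inner_le d (inner_triNormal_edge a b (c 0))
    have h2 := mul_le_mul_of_nonneg_left (hd 0) hu.le
    have h3 : ‖triNormal a b (c 0)‖ * (δ * ‖b - a‖) ≤ ‖triNormal a b (c 0)‖ * L := by
      linarith
    exact le_of_mul_le_mul_left h3 (hnn 0)
  have hL : 0 < L := (mul_pos hδ hu).trans_le hLu
  have hdet : ∀ i, inner ℝ (cross d (b - a)) (c i - a) = inner ℝ (triNormal a b (c i)) (d : E3) :=
    fun i => (inner_cross_cyclic _ _ _).symm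
  -- the sign of the common side
  obtain ⟨s, hs, hs'⟩ : ∃ s : ℝ, s ^ 2 = 1 ∧
      ∀ i, s * inner ℝ (triNormal a b (c i)) (d : E3) =
        -|inner ℝ (triNormal a b (c i)) (d : E3)| := by
    rcases mul_pos_iff.1 hsign with ⟨h1, h2⟩ | ⟨h1, h2⟩
    · refine ⟨-1, by norm_num, fun i => ?_⟩
      fin_cases i
      · simp only [Fin.zero_eta]; rw [abs_of_pos h1]; ring
      · simp only [Fin.mk_one]; rw [abs_of_pos h2]; ring
    · refine ⟨1, by norm_num, fun i => ?_⟩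
      fin_cases i
      · simp only [Fin.zero_eta]; rw [abs_of_neg h1]; ring
      · simp only [Fin.mk_one]; rw [abs_of_neg h2]; ring
  have hprojd : inner ℝ (projAlong d (b - a)) (d : E3) = 0 := by
    rw [projAlong, inner_sub_left, inner_smul_left, real_inner_self_eq_norm_sq, hd1,
      real_inner_comm]
    simp
  have hcd : inner ℝ (cross d (b - a)) (d : E3) = 0 := inner_cross_left _ _
  have hcu : inner ℝ (cross d (b - a)) (b - a) = 0 := inner_cross_right _ _
  have habss : |s| = 1 := by
    rw [← sq_eq_sq₀ (abs_nonneg _) zero_le_one, sq_abs, hs, one_pow]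
  -- The vectors `m` and `ν` form an orthonormal basis of the plane of view, and `s` orients `ν`
  -- away from both apexes. By the triple product identity `hdet`, `σ i` is the apparent distance of
  -- the apex `c i` from the line of the edge.
  refine exists_extremal_silhouette f hS d (m := L⁻¹ • projAlong d (b - a))
    (ν := (s * L⁻¹) • cross d (b - a)) (L := L)
    (σ := fun i => |inner ℝ (triNormal a b (c i)) (d : E3)| / L) (ε := ε) (c := c)
    ?_ ?_ ?_ ?_ ?_ hL ?_ ?_ hε ?_ ?_ ?_ ?_ hO hTP hdist hOT hTO
  · rw [norm_smul, norm_inv, norm_norm, inv_mul_cancel₀ hL.ne']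
  · rw [norm_smul, ← norm_projAlong_eq_norm_cross, norm_mul, Real.norm_eq_abs, habss, norm_inv,
      norm_norm, one_mul, inv_mul_cancel₀ hL.ne']
  · rw [inner_smul_left, hprojd, mul_zero]
  · rw [inner_smul_left, inner_smul_right, projAlong, inner_sub_left, inner_smul_left,
      real_inner_comm, hcu, real_inner_comm (cross _ _), hcd]
    simp
  · rw [inner_smul_left, hcd, mul_zero]
  · have h1 : inner ℝ (projAlong d (b - a)) (b - a) = L ^ 2 := by
      rw [hLdef, norm_projAlong_sq, projAlong, inner_sub_left, inner_smul_left,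
        real_inner_self_eq_norm_sq]
      simp [sq]
    rw [inner_smul_left, h1]
    simp only [conj_trivial]
    field_simp
  · rw [inner_smul_left, hcu, mul_zero]
  · intro i
    rw [inner_smul_left, hdet]
    simp only [conj_trivial]
    rw [mul_right_comm, hs' i]
    ring
  · intro i
    simp only [div_mul_cancel₀ _ hL.ne']
    calc 12 * ε i * ‖c i - a‖ ≤ δ * h i * ‖c i - a‖ :=
          mul_le_mul_of_nonneg_right (hεh i) (norm_nonneg _)
      _ = δ * (h i * ‖c i - a‖) := by ring
      _ ≤ δ * ‖triNormal a b (c i)‖ := by gcongr; exact hh1 i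
      _ ≤ _ := hd i
  · intro i
    simp only [div_mul_cancel₀ _ hL.ne']
    calc 12 * ε i * ‖c i - b‖ ≤ δ * h i * ‖c i - b‖ :=
          mul_le_mul_of_nonneg_right (hεh i) (norm_nonneg _)
      _ = δ * (h i * ‖c i - b‖) := by ring
      _ ≤ δ * ‖triNormal a b (c i)‖ := by gcongr; exact hh2 i
      _ ≤ _ := hd i
  · intro i
    calc 12 * ε i ≤ δ * h i := hεh i
      _ ≤ δ * ‖b - a‖ := by gcongr; exact hh3 i
      _ ≤ L := hLu

/-! ### Open stars of edges in a triangle mesh -/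

/-- The complement of the faces that do not contain `e`. Its intersection with the underlying space
of the complex is the open star of `e`. -/
def starNbhd (K : Geometry.SimplicialComplex ℝ E3) (e : Finset E3) : Set E3 :=
  (⋃ s ∈ {s ∈ K.faces | ¬ e ⊆ s}, convexHull ℝ (s : Set E3))ᶜ

section star

variable {K : Geometry.SimplicialComplex ℝ E3} {e : Finset E3}

theorem isOpen_starNbhd (hK : K.faces.Finite) (e : Finset E3) : IsOpen (starNbhd K e) := by
  rw [starNbhd, isOpen_compl_iff]
  exact (hK.subset (sep_subset _ _)).isClosed_biUnion fun s _ =>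
    (s.finite_toSet.isCompact_convexHull ℝ).isClosed

theorem subset_of_mem_starNbhd {x : E3} (hx : x ∈ starNbhd K e) {s : Finset E3} (hs : s ∈ K.faces)
    (hxs : x ∈ convexHull ℝ (s : Set E3)) : e ⊆ s := by
  by_contra h
  exact hx (mem_biUnion (show s ∈ {s ∈ K.faces | ¬ e ⊆ s} from ⟨hs, h⟩) hxs)

theorem exists_face_of_notMem_starNbhd {x : E3} (hx : x ∉ starNbhd K e) :
    ∃ s ∈ K.faces, ¬ e ⊆ s ∧ x ∈ convexHull ℝ (s : Set E3) := by
  rw [starNbhd, notMem_compl_iff, mem_iUnion₂] at hx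
  obtain ⟨s, hs, hxs⟩ := hx
  exact ⟨s, hs.1, hs.2, hxs⟩

theorem exists_triangle_of_mem_space {n : ℕ} (hK : IsTriangleMesh K n) {x : E3}
    (hx : x ∈ K.space) : ∃ T ∈ K.faces, T.card = 3 ∧ x ∈ convexHull ℝ (T : Set E3) := by
  obtain ⟨s, hs, hxs⟩ := Geometry.SimplicialComplex.mem_space_iff.1 hx
  obtain ⟨T, hT, hT3, hsT⟩ := hK.pure s hs
  exact ⟨T, hT, hT3, convexHull_mono (Finset.coe_subset.2 hsT) hxs⟩

-- A point outside the star lies in a face that misses `a` or `b`. In a simplicial complex, this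
-- face meets the triangle only in the hull of their common vertices, which is contained in one of
-- the two other sides.
open Classical in
theorem triangle_subset_starNbhd_union {a b c : E3} (hT : ({a, b, c} : Finset E3) ∈ K.faces) :
    convexHull ℝ {a, b, c} ⊆
      starNbhd K {a, b} ∪ (segment ℝ a c ∪ segment ℝ b c) := by
  intro x hx
  by_cases hxs : x ∈ starNbhd K {a, b}
  · exact Or.inl hxs
  right
  obtain ⟨s, hs, hes, hxs⟩ := exists_face_of_notMem_starNbhd hxs
  have h1 := K.inter_subset_convexHull hs hT ⟨hxs, by simpa using hx⟩
  by_cases ha : a ∈ s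
  · left
    have hb : b ∉ s := fun hb => hes (by simp [Finset.insert_subset_iff, ha, hb])
    rw [← convexHull_pair]
    refine convexHull_mono ?_ h1
    rintro y ⟨hy1, hy2⟩
    simp only [Finset.coe_insert, Finset.coe_singleton, mem_insert_iff, mem_singleton_iff] at hy2 ⊢
    rcases hy2 with rfl | rfl | rfl
    · simp
    · exact absurd hy1 hb
    · simp
  · right
    rw [← convexHull_pair]
    refine convexHull_mono ?_ h1
    rintro y ⟨hy1, hy2⟩
    simp only [Finset.coe_insert, Finset.coe_singleton, mem_insert_iff, mem_singleton_iff] at hy2 ⊢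
    rcases hy2 with rfl | rfl | rfl
    · exact absurd hy1 ha
    · simp
    · simp

open Classical in
theorem openSegment_subset_starNbhd {a b : E3} (hab : a ≠ b) (he : ({a, b} : Finset E3) ∈ K.faces) :
    openSegment ℝ a b ⊆ starNbhd K {a, b} := by
  intro x hx
  by_contra hxs
  obtain ⟨s, hs, hes, hxs⟩ := exists_face_of_notMem_starNbhd hxs
  have hx' : x ∈ convexHull ℝ (({a, b} : Finset E3) : Set E3) := by
    rw [Finset.coe_pair, convexHull_pair]
    exact openSegment_subset_segment ℝ a b hx
  have h1 := K.inter_subset_convexHull hs he ⟨hxs, hx'⟩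
  by_cases ha : a ∈ s
  · have hb : b ∉ s := fun hb => hes (by simp [Finset.insert_subset_iff, ha, hb])
    have h2 : x ∈ convexHull ℝ {a} := by
      refine convexHull_mono ?_ h1
      rintro y ⟨hy1, hy2⟩
      simp only [Finset.coe_insert, Finset.coe_singleton, mem_insert_iff, mem_singleton_iff] at hy2 ⊢
      rcases hy2 with rfl | rfl
      · rfl
      · exact absurd hy1 hb
    rw [convexHull_singleton, mem_singleton_iff] at h2
    subst h2
    exact hab (left_mem_openSegment_iff.1 hx)
  · have h2 : x ∈ convexHull ℝ {b} := by
      refine convexHull_mono ?_ h1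
      rintro y ⟨hy1, hy2⟩
      simp only [Finset.coe_insert, Finset.coe_singleton, mem_insert_iff, mem_singleton_iff] at hy2 ⊢
      rcases hy2 with rfl | rfl
      · exact absurd hy1 ha
      · rfl
    rw [convexHull_singleton, mem_singleton_iff] at h2
    subst h2
    exact hab (right_mem_openSegment_iff.1 hx)

/-- The edges of the complex. -/
def meshEdges (K : Geometry.SimplicialComplex ℝ E3) : Set (Finset E3) :=
  {e ∈ K.faces | e.card = 2}

/-- All edges whose star contains `x` are edges of any one triangle that contains `x`. This is the
overlap bound for the silhouette pieces. -/
theorem encard_edges_starNbhd_le {n : ℕ} (hK : IsTriangleMesh K n) {x : E3} (hx : x ∈ K.space) :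
    {e ∈ meshEdges K | x ∈ starNbhd K e}.encard ≤ 3 := by
  classical
  obtain ⟨T, hT, hT3, hxT⟩ := exists_triangle_of_mem_space hK hx
  have h1 : {e ∈ meshEdges K | x ∈ starNbhd K e} ⊆ (T.powersetCard 2 : Finset (Finset E3)) := by
    rintro e ⟨he, hxe⟩
    rw [Finset.mem_coe, Finset.mem_powersetCard]
    exact ⟨subset_of_mem_starNbhd hxe hT hxT, he.2⟩
  refine (encard_le_encard h1).trans ?_
  rw [encard_coe_eq_coe_finsetCard, Finset.card_powersetCard, hT3]
  simp [Nat.choose]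

theorem finite_meshEdges (hK : K.faces.Finite) : (meshEdges K).Finite :=
  hK.subset (sep_subset _ _)

theorem ncard_meshEdges_le {n : ℕ} (hK : IsTriangleMesh K n) : (meshEdges K).ncard ≤ 3 * n := by
  classical
  have hfin : {T ∈ K.faces | T.card = 3}.Finite := hK.finite.subset (sep_subset _ _)
  have h1 : meshEdges K ⊆ ((hfin.toFinset.biUnion fun T => T.powersetCard 2 :
      Finset (Finset E3)) : Set (Finset E3)) := by
    rintro e ⟨he, he2⟩
    obtain ⟨T, hT, hT3, heT⟩ := hK.pure e he
    rw [Finset.mem_coe, Finset.mem_biUnion]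
    exact ⟨T, by simpa using ⟨hT, hT3⟩, Finset.mem_powersetCard.2 ⟨heT, he2⟩⟩
  calc (meshEdges K).ncard ≤ _ := ncard_le_ncard h1 (Finset.finite_toSet _)
    _ = (hfin.toFinset.biUnion fun T => T.powersetCard 2).card := ncard_coe_finset _
    _ ≤ hfin.toFinset.card * 3 := by
        refine Finset.card_biUnion_le_card_mul _ _ _ fun T hT => ?_
        rw [Finset.card_powersetCard, (by simpa using hT : T ∈ K.faces ∧ T.card = 3).2]
        simp [Nat.choose]
    _ = 3 * n := by
        rw [← ncard_eq_toFinset_card _ hfin, hK.card_triangles, mul_comm]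

end star

/-! ### Boundary edges -/

theorem eq_of_mem_starNbhd_of_mem_convexHull {K : Geometry.SimplicialComplex ℝ E3} {e₁ e₂ : Finset E3}
    (h₁ : e₁ ∈ meshEdges K) (h₂ : e₂ ∈ meshEdges K) {x : E3} (hx₁ : x ∈ starNbhd K e₁)
    (hx₂ : x ∈ convexHull ℝ (e₂ : Set E3)) : e₁ = e₂ :=
  Finset.eq_of_subset_of_card_le (subset_of_mem_starNbhd hx₁ h₂.1 hx₂) (by rw [h₁.2, h₂.2])

-- Within the open star of the edge the mesh is just its only triangle, a convex set supported along
-- the edge by the plane orthogonal to the altitude `g`.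
open Classical in
theorem openSegment_boundaryEdge_subset {K : Geometry.SimplicialComplex ℝ E3} {n : ℕ}
    (hK : IsTriangleMesh K n) {S : Set E3} (f : K.space ≃ₜ S) {a b : E3} (hab : a ≠ b)
    (he : ({a, b} : Finset E3) ∈ K.faces) (hb : IsBoundaryEdge K {a, b})
    (hheight : ∀ T ∈ K.faces, T.card = 3 → 0 < minHeight T) :
    extendMap f '' openSegment ℝ a b ⊆ surfaceBoundary S := by
  obtain ⟨T, ⟨hT, hT3, heT⟩, huniq⟩ := hb
  have haT : a ∈ T := heT (by simp)
  have hbT : b ∈ T := heT (by simp)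
  obtain ⟨c, hcT, hce⟩ : ∃ c ∈ T, c ∉ ({a, b} : Finset E3) := by
    by_contra! h
    have := Finset.card_le_card h
    rw [hT3, Finset.card_pair hab] at this
    omega
  have hac : a ≠ c := fun h => hce (by simp [h])
  have hbc : b ≠ c := fun h => hce (by simp [h])
  have hTeq : T = {a, b, c} := by
    symm
    apply Finset.eq_of_subset_of_card_le
    · intro y hy
      simp only [Finset.mem_insert, Finset.mem_singleton] at hy
      rcases hy with rfl | rfl | rfl <;> assumption
    · rw [hT3, Finset.card_eq_three.2 ⟨a, b, c, hab, hac, hbc, rfl⟩]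
  rintro _ ⟨x, hx, rfl⟩
  have hxe : x ∈ convexHull ℝ (({a, b} : Finset E3) : Set E3) := by
    rw [Finset.coe_pair, convexHull_pair]
    exact openSegment_subset_segment ℝ a b hx
  have hxP : x ∈ K.space := Geometry.SimplicialComplex.convexHull_subset_space he hxe
  have hv : b - a ≠ 0 := sub_ne_zero.2 hab.symm
  set l := inner ℝ (b - a) (c - a) / ‖b - a‖ ^ 2 with hl
  set g := (c - a) - l • (b - a) with hg
  have hgab : inner ℝ g (b - a) = 0 := by
    have : ‖b - a‖ ^ 2 ≠ 0 := by positivity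
    rw [hg, inner_sub_left, inner_smul_left, real_inner_self_eq_norm_sq, real_inner_comm]
    simp only [conj_trivial]
    rw [hl, div_mul_cancel₀ _ this, sub_self]
  have hg0 : 0 < inner ℝ g (c - a) := by
    have h1 : inner ℝ g (c - a) = inner ℝ g g := by
      conv_rhs => rw [hg, ← hg, inner_sub_right g (c - a), inner_smul_right, hgab]
      ring
    rw [h1, real_inner_self_pos]
    intro h0
    have h2 := norm_sub_smul_mul_norm (c - a) (b - a) hv
    rw [← hl, ← hg, h0, norm_zero, zero_mul] at h2
    have h3 := minHeight_mul_le hbT haT hcT hab.symm hbc hac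
    have h4 : ‖triNormal b a c‖ = ‖cross (c - a) (b - a)‖ := by
      rw [triNormal_swap, norm_neg, ← sq_eq_sq₀ (norm_nonneg _) (norm_nonneg _), triNormal,
        norm_cross_sq, norm_cross_sq, real_inner_comm]
      ring
    rw [h4, ← h2] at h3
    have h5 := mul_pos (hheight T hT hT3) (norm_pos_iff.2 (sub_ne_zero.2 hbc.symm))
    linarith
  have hconv : Convex ℝ {y : E3 | inner ℝ g a ≤ inner ℝ g y} :=
    convex_halfSpace_ge (innerSL ℝ g).isLinear _
  have hlx : inner ℝ g x = inner ℝ g a := by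
    have := openSegment_subset_segment ℝ a b hx
    rw [segment_eq_image'] at this
    obtain ⟨t, -, rfl⟩ := this
    rw [inner_add_right, inner_smul_right, hgab]
    ring
  have key := mem_surfaceBoundary_of_convex f ⟨x, hxP⟩ (Q := convexHull ℝ (T : Set E3))
    (O := starNbhd K {a, b}) (convex_convexHull ℝ _)
    (Geometry.SimplicialComplex.convexHull_subset_space hT) (isOpen_starNbhd hK.finite _)
    (openSegment_subset_starNbhd hab he hx)
    (by
      rintro y ⟨hyP, hy⟩
      obtain ⟨T', hT', hT'3, hyT'⟩ := exists_triangle_of_mem_space hK hyP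
      rwa [← huniq T' ⟨hT', hT'3, subset_of_mem_starNbhd hy hT' hyT'⟩])
    (innerSL ℝ g)
    (by
      intro y hy
      have h1 : convexHull ℝ (T : Set E3) ⊆ {y : E3 | inner ℝ g a ≤ inner ℝ g y} := by
        refine convexHull_min ?_ hconv
        intro z hz
        rw [hTeq] at hz
        simp only [Finset.coe_insert, Finset.coe_singleton, mem_insert_iff, mem_singleton_iff] at hz
        simp only [mem_ofPred_eq]
        rcases hz with rfl | rfl | rfl
        · exact le_rfl
        · rw [inner_sub_right] at hgab; linarith
        · rw [inner_sub_right] at hg0; linarith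
      have h2 := h1 hy
      simp only [mem_ofPred_eq] at h2
      simpa [hlx] using h2)
    (y₁ := c) (subset_convexHull ℝ _ hcT)
    (by
      rw [inner_sub_right] at hg0
      simpa [hlx] using hg0)
  rw [extendMap_of_mem f hxP]
  exact key

/-- The 1-Lipschitz function "distance from `p`" takes all values between 0 and `dist p q` on `A`.
Points of the closure suffice, so the lemma applies to images of open edges. -/
theorem dist_le_hausdorffMeasure_of_isPreconnected {A : Set E3} (hA : IsPreconnected A) {p q : E3}
    (hp : p ∈ closure A) (hq : q ∈ closure A) :
    ENNReal.ofReal (dist p q) ≤ (Measure.hausdorffMeasure 1 : Measure E3) A := by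
  have hlip : LipschitzWith 1 (fun x : E3 => dist x p) := LipschitzWith.dist_left p
  have h1 : Ioo 0 (dist p q) ⊆ (fun x : E3 => dist x p) '' A := by
    rintro t ⟨ht0, ht1⟩
    obtain ⟨p', hp', hpp⟩ := Metric.mem_closure_iff.1 hp t ht0
    obtain ⟨q', hq', hqq⟩ := Metric.mem_closure_iff.1 hq (dist p q - t) (by linarith)
    refine hA.intermediate_value hp' hq' hlip.continuous.continuousOn ⟨?_, ?_⟩
    · rw [dist_comm]; exact hpp.le
    · have := dist_triangle p q' q
      rw [dist_comm q' p]
      rw [dist_comm q' q] at this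
      linarith
  calc ENNReal.ofReal (dist p q) = volume (Ioo 0 (dist p q)) := by rw [Real.volume_Ioo, sub_zero]
    _ ≤ volume ((fun x : E3 => dist x p) '' A) := measure_mono h1
    _ = (Measure.hausdorffMeasure 1 : Measure ℝ) ((fun x : E3 => dist x p) '' A) := by
        rw [hausdorffMeasure_real]
    _ ≤ _ := by simpa using hlip.hausdorffMeasure_image_le zero_le_one A

/-- The closeness hypothesis is a strict upper bound on a distance, so its right-hand side is
positive. -/
theorem minHeight_pos {K : Geometry.SimplicialComplex ℝ E3} {n : ℕ} {S : Set E3}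
    (f : K.space ≃ₜ S) {β : ℝ} (hn : 0 < n) (hβ : 0 < β) (hdist : DistanceHypothesis K n β f)
    {T : Finset E3} (hT : T ∈ K.faces) (hT3 : T.card = 3) : 0 < minHeight T := by
  have hsqrt : 0 < √(n : ℝ) := Real.sqrt_pos.2 (by exact_mod_cast hn)
  obtain ⟨x, hx⟩ := K.nonempty_of_mem_faces hT
  have hxT := subset_convexHull ℝ (T : Set E3) hx
  have h1 := hdist ⟨x, Geometry.SimplicialComplex.convexHull_subset_space hT hxT⟩ T hT hT3 hxT
  have h2 := dist_nonneg.trans_lt h1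
  rw [div_pos_iff_of_pos_right hsqrt] at h2
  exact pos_of_mul_pos_right h2 hβ.le

theorem dist_extendMap_lt {K : Geometry.SimplicialComplex ℝ E3} {n : ℕ} {S : Set E3}
    (f : K.space ≃ₜ S) {β : ℝ} (hdist : DistanceHypothesis K n β f)
    {T : Finset E3} (hT : T ∈ K.faces) (hT3 : T.card = 3) {x : E3}
    (hx : x ∈ convexHull ℝ (T : Set E3)) :
    dist x (extendMap f x) < β * minHeight T / √(n : ℝ) := by
  have hxP := Geometry.SimplicialComplex.convexHull_subset_space hT hx
  rw [extendMap_of_mem f hxP]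
  exact hdist ⟨x, hxP⟩ T hT hT3 hx

/-- The number of boundary edges is bounded by the length of the boundary. -/
theorem boundaryEdges_le {K : Geometry.SimplicialComplex ℝ E3} {n : ℕ} (hn : 0 < n)
    (hK : IsTriangleMesh K n) {S : Set E3} (f : K.space ≃ₜ S) {α β : ℝ} (hβ : 0 < β)
    (hedge : EdgeLengthHypothesis K n α) (hdist : DistanceHypothesis K n β f)
    (hnβ : 4 * β ≤ √(n : ℝ)) :
    ({e ∈ meshEdges K | IsBoundaryEdge K e}.ncard : ℝ≥0∞) * ENNReal.ofReal (α / (2 * √(n : ℝ))) ≤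
      Measure.hausdorffMeasure 1 (surfaceBoundary S) := by
  classical
  have hsqrt : 0 < √(n : ℝ) := Real.sqrt_pos.2 (by exact_mod_cast hn)
  have hheight := fun T hT hT3 => minHeight_pos f hn hβ hdist (T := T) hT hT3
  have hfin : {e ∈ meshEdges K | IsBoundaryEdge K e}.Finite :=
    (finite_meshEdges hK.finite).subset (sep_subset _ _)
  have hpair : ∀ e : hfin.toFinset, ∃ p : E3 × E3, p.1 ≠ p.2 ∧ (e : Finset E3) = {p.1, p.2} := by
    rintro ⟨e, he⟩
    obtain ⟨a, b, hab, h⟩ := Finset.card_eq_two.1 ((hfin.mem_toFinset.1 he).1.2)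
    exact ⟨(a, b), hab, h⟩
  choose p hp hpe using hpair
  set A : hfin.toFinset → Set E3 := fun e => extendMap f '' openSegment ℝ (p e).1 (p e).2 with hA
  have hmem : ∀ e : hfin.toFinset, (e : Finset E3) ∈ meshEdges K ∧ IsBoundaryEdge K e :=
    fun e => hfin.mem_toFinset.1 e.2
  have hface : ∀ e, ({(p e).1, (p e).2} : Finset E3) ∈ K.faces := fun e =>
    hpe e ▸ (hmem e).1.1
  have hsegP : ∀ e, segment ℝ (p e).1 (p e).2 ⊆ K.space := fun e => by
    have := Geometry.SimplicialComplex.convexHull_subset_space (hface e)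
    rwa [Finset.coe_pair, convexHull_pair] at this
  have hoP : ∀ e, openSegment ℝ (p e).1 (p e).2 ⊆ K.space := fun e =>
    (openSegment_subset_segment ℝ _ _).trans (hsegP e)
  have hAsub : ∀ e, A e ⊆ surfaceBoundary S := fun e =>
    openSegment_boundaryEdge_subset hK f (hp e) (hface e) (hpe e ▸ (hmem e).2) hheight
  have hAmeas : ∀ e, MeasurableSet (A e) := by
    intro e
    have h1 : openSegment ℝ (p e).1 (p e).2 = segment ℝ (p e).1 (p e).2 \ {(p e).1, (p e).2} := by
      ext x
      constructor
      · intro hx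
        refine ⟨openSegment_subset_segment ℝ _ _ hx, ?_⟩
        rintro (rfl | rfl)
        · exact hp e (left_mem_openSegment_iff.1 hx)
        · exact hp e (right_mem_openSegment_iff.1 hx)
      · rintro ⟨hx, hne⟩
        simp only [mem_insert_iff, mem_singleton_iff, not_or] at hne
        exact mem_openSegment_of_ne_left_right (Ne.symm hne.1) (Ne.symm hne.2) hx
    have hsub : ({(p e).1, (p e).2} : Set E3) ⊆ segment ℝ (p e).1 (p e).2 := by
      rintro x (rfl | rfl)
      · exact left_mem_segment ℝ _ _
      · exact right_mem_segment ℝ _ _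
    have h2 : A e = extendMap f '' (segment ℝ (p e).1 (p e).2) \
        extendMap f '' {(p e).1, (p e).2} := by
      rw [← ((injOn_extendMap f).mono (hsegP e)).image_sdiff_subset hsub, ← h1]
    have h3 : IsCompact (segment ℝ (p e).1 (p e).2) := by
      rw [← convexHull_pair]
      exact (Set.toFinite _).isCompact_convexHull ℝ
    rw [h2]
    exact (h3.image_of_continuousOn
      ((continuousOn_extendMap f).mono (hsegP e))).measurableSet.diff
        ((Set.toFinite _).image _).measurableSet
  have hdisj : Pairwise (Function.onFun Disjoint A) := by
    intro e e' hee'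
    rw [Function.onFun, disjoint_left]
    rintro _ ⟨x, hx, rfl⟩ ⟨x', hx', hxx'⟩
    have := injOn_extendMap f (hoP e' hx') (hoP e hx) hxx'
    subst this
    refine hee' (Subtype.ext (eq_of_mem_starNbhd_of_mem_convexHull (hmem e).1 (hmem e').1 (x := x') ?_ ?_))
    · rw [hpe e]
      exact openSegment_subset_starNbhd (hp e) (hface e) hx
    · rw [hpe e', Finset.coe_pair, convexHull_pair]
      exact openSegment_subset_segment ℝ _ _ hx'
  have hlen : ∀ e, ENNReal.ofReal (α / (2 * √(n : ℝ))) ≤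
      (Measure.hausdorffMeasure 1 : Measure E3) (A e) := by
    intro e
    have hcl : ∀ x ∈ segment ℝ (p e).1 (p e).2, extendMap f x ∈ closure (A e) := by
      intro x hx
      have hc : ContinuousOn (extendMap f) (closure (openSegment ℝ (p e).1 (p e).2)) := by
        rw [closure_openSegment]
        exact (continuousOn_extendMap f).mono (hsegP e)
      refine hc.image_closure ⟨x, ?_, rfl⟩
      rwa [closure_openSegment]
    refine le_trans (ENNReal.ofReal_le_ofReal ?_) (dist_le_hausdorffMeasure_of_isPreconnected
      ((convex_openSegment _ _).isPreconnected.image _ ((continuousOn_extendMap f).mono (hoP e)))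
      (hcl _ (left_mem_segment ℝ _ _)) (hcl _ (right_mem_segment ℝ _ _)))
    obtain ⟨T, hT, hT3, heT⟩ := hK.pure _ (hface e)
    have h1T : (p e).1 ∈ T := heT (by simp)
    have h2T : (p e).2 ∈ T := heT (by simp)
    have hle := minHeight_le_dist h1T h2T (hp e)
    have d1 := dist_extendMap_lt f hdist hT hT3 (subset_convexHull ℝ _ h1T)
    have d2 := dist_extendMap_lt f hdist hT hT3 (subset_convexHull ℝ _ h2T)
    -- A height is at most the length of the edge, so each endpoint moves by at most a quarter of
    -- this length and the images of the endpoints keep at least half of their distance.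
    have hquarter : β * minHeight T / √(n : ℝ) ≤ dist (p e).1 (p e).2 / 4 := by
      rw [div_le_iff₀ hsqrt]
      have := minHeight_nonneg T
      nlinarith
    have hed := hedge _ _ (hp e) (hface e)
    have t1 := dist_triangle4 (p e).1 (extendMap f (p e).1) (extendMap f (p e).2) (p e).2
    rw [dist_comm (extendMap f (p e).2) (p e).2] at t1
    have : α / (2 * √(n : ℝ)) = α / √(n : ℝ) / 2 := by rw [mul_comm, div_div]
    rw [this]
    linarith
  calc ({e ∈ meshEdges K | IsBoundaryEdge K e}.ncard : ℝ≥0∞) * ENNReal.ofReal (α / (2 * √(n : ℝ)))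
      = ∑ _e : hfin.toFinset, ENNReal.ofReal (α / (2 * √(n : ℝ))) := by
        rw [Finset.sum_const, Finset.card_univ, Fintype.card_coe, nsmul_eq_mul,
          ncard_eq_toFinset_card _ hfin]
    _ ≤ ∑ e : hfin.toFinset, (Measure.hausdorffMeasure 1 : Measure E3) (A e) :=
        Finset.sum_le_sum fun e _ => hlen e
    _ = (Measure.hausdorffMeasure 1 : Measure E3) (⋃ e, A e) := by
        rw [measure_iUnion hdisj hAmeas, tsum_fintype]
    _ ≤ _ := measure_mono (iUnion_subset hAsub)

section volumes

open scoped Pointwise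

/-! ### Volumes of slabs and double wedges -/

theorem finrank_E3 : Module.finrank ℝ E3 = 3 := by simp

theorem volume_smul_E3 (r : ℝ) (hr : 0 ≤ r) (s : Set E3) :
    volume (r • s) = ENNReal.ofReal (r ^ 3) * volume s := by
  rw [Measure.addHaar_smul, finrank_E3, abs_of_nonneg (by positivity)]

/-- At least 1/η disjoint translates of the slab, shifted by multiples of 2η along `v`, fit into the
ball of radius 6: the shifts are at most 4 and the slab lies in a ball of radius 2. For η > 1 the
bound is trivial. -/
theorem volume_slab_le {v : E3} (hv : ‖v‖ = 1) {η : ℝ} (hη : 0 < η) :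
    volume {w ∈ ball (0 : E3) 2 | |inner ℝ v w| < η} ≤
      ENNReal.ofReal η * volume (ball (0 : E3) 6) := by
  set X : Set E3 := {w ∈ ball (0 : E3) 2 | |inner ℝ v w| < η} with hX
  have hXm : MeasurableSet X :=
    measurableSet_ball.inter
      (isOpen_lt (by fun_prop : Continuous fun w : E3 => |inner ℝ v w|) continuous_const).measurableSet
  have hvv : inner ℝ v v = (1 : ℝ) := by rw [real_inner_self_eq_norm_sq, hv]; norm_num
  rcases le_or_gt η 1 with h1 | h1
  · set M : ℕ := ⌊1 / η⌋₊ + 1 with hM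
    have hM1 : 1 / η ≤ M := (Nat.lt_floor_add_one (1 / η)).le.trans (by simp [hM])
    have hM2 : (M : ℝ) * η ≤ 2 := by
      have : (M : ℝ) ≤ 1 / η + 1 := by
        rw [hM]; push_cast
        linarith [Nat.floor_le (a := 1 / η) (by positivity)]
      calc (M : ℝ) * η ≤ (1 / η + 1) * η := by gcongr
        _ = 1 + η := by field_simp
        _ ≤ 2 := by linarith
    let Y : Fin M → Set E3 := fun k => (fun w => ((2 * (k : ℝ) * η) • v) + w) '' X
    have hYvol : ∀ k, volume (Y k) = volume X := fun k => by
      simp only [Y, image_add_left]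
      exact measure_preimage_add _ _ _
    have hYm : ∀ k, MeasurableSet (Y k) := fun k => by
      simp only [Y, image_add_left]
      exact measurable_const_add _ hXm
    have hYd : Pairwise (Function.onFun Disjoint Y) := by
      intro k l hkl
      rw [Function.onFun, disjoint_left]
      rintro _ ⟨w, ⟨-, hw⟩, rfl⟩ ⟨w', ⟨-, hw'⟩, h⟩
      simp only at h
      have h2 := congrArg (fun z => inner ℝ v z) h
      simp only [inner_add_right, inner_smul_right, hvv, mul_one] at h2
      rw [abs_lt] at hw hw'
      rcases lt_or_gt_of_ne (fun h => hkl (Fin.ext h) : (k : ℕ) ≠ l) with h3 | h3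
      · have h4 : ((k : ℕ) : ℝ) + 1 ≤ (l : ℕ) := by exact_mod_cast h3
        nlinarith
      · have h4 : ((l : ℕ) : ℝ) + 1 ≤ (k : ℕ) := by exact_mod_cast h3
        nlinarith
    have hYsub : (⋃ k, Y k) ⊆ ball 0 6 := by
      refine iUnion_subset fun k => ?_
      rintro _ ⟨w, ⟨hw, -⟩, rfl⟩
      rw [mem_ball_zero_iff] at hw ⊢
      have h3 : ‖(2 * (k : ℝ) * η) • v‖ ≤ 4 := by
        rw [norm_smul, hv, mul_one, Real.norm_of_nonneg (by positivity)]
        have : ((k : ℕ) : ℝ) ≤ M := by exact_mod_cast k.2.le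
        nlinarith
      linarith [norm_add_le ((2 * (k : ℝ) * η) • v) w]
    have h2 : (M : ℝ≥0∞) * volume X ≤ volume (ball (0 : E3) 6) := by
      calc (M : ℝ≥0∞) * volume X = ∑ k, volume (Y k) := by simp [hYvol]
        _ = volume (⋃ k, Y k) := by rw [measure_iUnion hYd hYm, tsum_fintype]
        _ ≤ _ := measure_mono hYsub
    have h3 : (1 : ℝ≥0∞) ≤ ENNReal.ofReal η * M := by
      rw [← ENNReal.ofReal_natCast, ← ENNReal.ofReal_mul hη.le, ENNReal.one_le_ofReal]
      rw [div_le_iff₀ hη] at hM1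
      linarith
    calc volume X = 1 * volume X := (one_mul _).symm
      _ ≤ ENNReal.ofReal η * M * volume X := by gcongr
      _ = ENNReal.ofReal η * (M * volume X) := mul_assoc _ _ _
      _ ≤ _ := by gcongr
  · calc volume X ≤ volume (ball (0 : E3) 6) :=
        measure_mono fun w hw => ball_subset_ball (by norm_num) hw.1
      _ = 1 * volume (ball (0 : E3) 6) := (one_mul _).symm
      _ ≤ _ := by
        gcongr
        rw [ENNReal.one_le_ofReal]
        exact h1.le

/-- The part of the double wedge between the planes with normals `n₁` and `n₂` around the
axis `u`, in a cylinder with radius `ρ` around the axis. -/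
def wedgeCylinder (u n₁ n₂ : E3) (ρ : ℝ) (I : Set ℝ) : Set E3 :=
  {w | 0 < inner ℝ n₁ w * inner ℝ n₂ w ∧ ‖w - inner ℝ u w • u‖ < ρ ∧ inner ℝ u w ∈ I}

/-! ### Self-similarity of double wedges and comparison with their directions -/

section wedge

variable {u n₁ n₂ : E3}

theorem wedgeCylinder_translate (hu : ‖u‖ = 1) (h₁ : inner ℝ n₁ u = 0) (h₂ : inner ℝ n₂ u = 0)
    (ρ k : ℝ) (I : Set ℝ) : volume (wedgeCylinder u n₁ n₂ ρ ((fun t => k + t) ⁻¹' I)) =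
      volume (wedgeCylinder u n₁ n₂ ρ I) := by
  have huu : inner ℝ u u = (1 : ℝ) := by rw [real_inner_self_eq_norm_sq, hu]; norm_num
  have : wedgeCylinder u n₁ n₂ ρ ((fun t => k + t) ⁻¹' I) =
      (fun w => k • u + w) ⁻¹' wedgeCylinder u n₁ n₂ ρ I := by
    ext w
    simp only [wedgeCylinder, mem_ofPred_eq, mem_preimage, inner_add_right, inner_smul_right, h₁,
      h₂, huu, mul_zero, zero_add, mul_one, add_smul, add_sub_add_left_eq_sub]
  rw [this]
  exact measure_preimage_add _ _ _

theorem wedgeCylinder_scale (ρ : ℝ) {r : ℝ} (hr : 0 < r) (I : Set ℝ) :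
    wedgeCylinder u n₁ n₂ (r * ρ) I =
      r • wedgeCylinder u n₁ n₂ ρ ((fun t => r * t) ⁻¹' I) := by
  ext w
  rw [mem_smul_set_iff_inv_smul_mem₀ hr.ne']
  simp only [wedgeCylinder, mem_ofPred_eq, mem_preimage, inner_smul_right]
  have e1 : r⁻¹ • w - (r⁻¹ * inner ℝ u w) • u = r⁻¹ • (w - inner ℝ u w • u) := by
    rw [smul_sub, mul_smul]
  have e2 : ‖r⁻¹ • (w - inner ℝ u w • u)‖ < ρ ↔ ‖w - inner ℝ u w • u‖ < r * ρ := by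
    rw [norm_smul, norm_inv, Real.norm_of_nonneg hr.le, inv_mul_lt_iff₀ hr]
  have e3 : r⁻¹ * inner ℝ n₁ w * (r⁻¹ * inner ℝ n₂ w) =
      r⁻¹ ^ 2 * (inner ℝ n₁ w * inner ℝ n₂ w) := by ring
  have e4 : (0 < r⁻¹ ^ 2 * (inner ℝ n₁ w * inner ℝ n₂ w)) ↔ 0 < inner ℝ n₁ w * inner ℝ n₂ w :=
    mul_pos_iff_of_pos_left (by positivity)
  rw [e1, e2, e3, e4, mul_inv_cancel_left₀ hr.ne']

theorem wedgeCylinder_subset_ball (hu : ‖u‖ = 1) :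
    wedgeCylinder u n₁ n₂ 1 (Ico (-1) 1) ⊆ ball 0 2 := by
  rintro w ⟨-, h2, h3⟩
  have e : w = (w - inner ℝ u w • u) + inner ℝ u w • u := by abel
  have h4 : ‖inner ℝ u w • u‖ ≤ 1 := by
    rw [norm_smul, hu, mul_one, Real.norm_eq_abs, abs_le]
    exact ⟨h3.1, h3.2.le⟩
  have h5 : ‖w‖ ≤ ‖w - inner ℝ u w • u‖ + ‖inner ℝ u w • u‖ := by
    conv_lhs => rw [e]
    exact norm_add_le _ _
  rw [mem_ball_zero_iff]
  linarith

/-- Doubling the thin piece multiplies its volume by 8 and gives a piece of radius 1 and twice the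
length, which two axial translates of the wide piece cover. This takes the place of cylindrical
coordinates. -/
theorem volume_wedgeCylinder_half (hu : ‖u‖ = 1) (h₁ : inner ℝ n₁ u = 0)
    (h₂ : inner ℝ n₂ u = 0) :
    4 * volume (wedgeCylinder u n₁ n₂ (1 / 2) (Ico (-1) 1)) ≤
      volume (wedgeCylinder u n₁ n₂ 1 (Ico (-1) 1)) := by
  have hs : wedgeCylinder u n₁ n₂ 1 (Ico (-2) 2) =
      (2 : ℝ) • wedgeCylinder u n₁ n₂ (1 / 2) (Ico (-1) 1) := by
    have h := wedgeCylinder_scale (u := u) (n₁ := n₁) (n₂ := n₂) (1 / 2) zero_lt_two (Ico (-2) 2)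
    have e : (fun t : ℝ => 2 * t) ⁻¹' Ico (-2) 2 = Ico (-1) 1 := by
      ext t
      simp only [mem_preimage, mem_Ico]
      constructor <;> rintro ⟨h1, h2⟩ <;> constructor <;> linarith
    rw [e] at h
    rw [← h]
    norm_num
  have hvol := volume_smul_E3 2 zero_le_two (wedgeCylinder u n₁ n₂ (1 / 2) (Ico (-1) 1))
  rw [← hs] at hvol
  have hsplit : wedgeCylinder u n₁ n₂ 1 (Ico (-2) 2) ⊆
      wedgeCylinder u n₁ n₂ 1 ((fun t => 1 + t) ⁻¹' Ico (-1) 1) ∪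
        wedgeCylinder u n₁ n₂ 1 ((fun t => -1 + t) ⁻¹' Ico (-1) 1) := by
    rintro w ⟨h3, h4, h5, h6⟩
    rcases lt_or_ge (inner ℝ u w) (0 : ℝ) with h | h
    · left
      exact ⟨h3, h4, by simp only; linarith, by simp only; linarith⟩
    · right
      exact ⟨h3, h4, by simp only; linarith, by simp only; linarith⟩
  have h8 := (measure_mono hsplit).trans (measure_union_le (μ := volume) _ _)
  rw [hvol, wedgeCylinder_translate hu h₁ h₂, wedgeCylinder_translate hu h₁ h₂, ← two_mul] at h8
  have e8 : ENNReal.ofReal (2 ^ 3) = 2 * 4 := by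
    rw [show (2 : ℝ) ^ 3 = ((8 : ℕ) : ℝ) by norm_num, ENNReal.ofReal_natCast]; norm_num
  rw [e8, mul_assoc] at h8
  exact (ENNReal.mul_le_mul_iff_right (by norm_num) (by norm_num)).1 h8

/-- The part near the axis holds at most a quarter of the volume, so at least half is away from the
axis, where directions make a definite angle with it. -/
theorem volume_wedgeCylinder_le (hu : ‖u‖ = 1) (h₁ : inner ℝ n₁ u = 0) (h₂ : inner ℝ n₂ u = 0) :
    volume (wedgeCylinder u n₁ n₂ 1 (Ico (-1) 1)) ≤
      2 * volume {w ∈ wedgeCylinder u n₁ n₂ 1 (Ico (-1) 1) | 1 / 2 ≤ ‖w - inner ℝ u w • u‖} := by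
  set V := wedgeCylinder u n₁ n₂ 1 (Ico (-1) 1)
  set V' := wedgeCylinder u n₁ n₂ (1 / 2) (Ico (-1) 1)
  set X := {w ∈ V | 1 / 2 ≤ ‖w - inner ℝ u w • u‖}
  have hsub : V ⊆ V' ∪ X := by
    intro w hw
    rcases lt_or_ge ‖w - inner ℝ u w • u‖ (1 / 2) with h | h
    · exact Or.inl ⟨hw.1, h, hw.2.2⟩
    · exact Or.inr ⟨hw, h⟩
  have hVfin : volume V ≠ ∞ := by
    exact ((measure_mono (wedgeCylinder_subset_ball hu)).trans_lt measure_ball_lt_top).ne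
  have hXfin : volume X ≠ ∞ := ((measure_mono (sep_subset _ _)).trans_lt hVfin.lt_top).ne
  have hV'fin : volume V' ≠ ∞ := by
    refine ((measure_mono (t := V) fun w hw => ?_).trans_lt hVfin.lt_top).ne
    exact ⟨hw.1, hw.2.1.trans (by norm_num), hw.2.2⟩
  have a1 := (measure_mono hsub).trans (measure_union_le (μ := volume) V' X)
  have a2 : 4 * volume V' ≤ volume V := volume_wedgeCylinder_half hu h₁ h₂
  rw [← ENNReal.toReal_le_toReal hVfin (by finiteness), ENNReal.toReal_add hV'fin hXfin] at a1
  rw [← ENNReal.toReal_le_toReal (by finiteness) hVfin, ENNReal.toReal_mul] at a2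
  rw [← ENNReal.toReal_le_toReal hVfin (by finiteness), ENNReal.toReal_mul]
  simp only [ENNReal.toReal_ofNat] at a1 a2 ⊢
  have : 0 ≤ (volume X).toReal := ENNReal.toReal_nonneg
  linarith

/-- The directions in the double wedge between the planes with normals `n₁` and `n₂` that are
not almost parallel to the planes or to the axis `u`. -/
def transverseDirections (u n₁ n₂ : E3) (δ : ℝ) : Set (sphere (0 : E3) 1) :=
  {d | 0 < inner ℝ n₁ (d : E3) * inner ℝ n₂ (d : E3) ∧
    δ * ‖n₁‖ ≤ |inner ℝ n₁ (d : E3)| ∧ δ * ‖n₂‖ ≤ |inner ℝ n₂ (d : E3)| ∧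
    ‖u‖ / 4 ≤ ‖projAlong d u‖}

theorem measurableSet_transverseDirections (δ : ℝ) :
    MeasurableSet (transverseDirections u n₁ n₂ δ) := by
  have hc : ∀ n : E3, Continuous fun d : sphere (0 : E3) 1 => (inner ℝ n (d : E3) : ℝ) :=
    fun n => by fun_prop
  have hp : Continuous fun d : sphere (0 : E3) 1 => ‖projAlong d u‖ := by
    unfold projAlong; fun_prop
  exact (isOpen_lt continuous_const ((hc n₁).mul (hc n₂))).measurableSet.inter
    ((isClosed_le continuous_const (hc n₁).abs).measurableSet.inter
      ((isClosed_le continuous_const (hc n₂).abs).measurableSet.inter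
        (isClosed_le continuous_const hp).measurableSet))

theorem norm_projAlong_eq (hu : ‖u‖ = 1) (d : sphere (0 : E3) 1) :
    ‖projAlong d u‖ = ‖(d : E3) - inner ℝ u (d : E3) • u‖ := by
  have hd : ‖(d : E3)‖ = 1 := norm_eq_of_mem_sphere d
  rw [← sq_eq_sq₀ (norm_nonneg _) (norm_nonneg _), norm_projAlong_sq, norm_sub_sq_real, norm_smul,
    inner_smul_right, real_inner_comm, hu, hd, mul_one, Real.norm_eq_abs, sq_abs]
  ring

theorem transverseDirections_smul {r : ℝ} (hr : 0 < r) (δ : ℝ) :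
    transverseDirections (r • u) n₁ n₂ δ = transverseDirections u n₁ n₂ δ := by
  ext d
  have h1 : projAlong d (r • u) = r • projAlong d u := by
    simp only [projAlong, inner_smul_right, smul_sub, mul_smul]
  simp only [transverseDirections, mem_ofPred_eq, h1, norm_smul, mul_div_assoc,
    mul_le_mul_iff_right₀ (norm_pos_iff.2 hr.ne')]

/-- Scale to a unit cylinder and keep its part at distance at least 1/2 from the axis. Its points
have norm below 2, so their directions have distance at least 1/4 from the axis. Each point is in
one of two slabs of half-width 2δ or in the cone of radius 2 over the transverse directions. -/
theorem volume_wedge_le_of_norm_eq_one (hu : ‖u‖ = 1) (h₁ : inner ℝ n₁ u = 0)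
    (h₂ : inner ℝ n₂ u = 0) (hn₁ : n₁ ≠ 0) (hn₂ : n₂ ≠ 0) {δ : ℝ} (hδ : 0 < δ) {R : ℝ}
    (hR : 0 < R) :
    volume {w ∈ ball (0 : E3) R | 0 < inner ℝ n₁ w * inner ℝ n₂ w} ≤
      ENNReal.ofReal (R ^ 3) * (16 * (volume : Measure E3).toSphere (transverseDirections u n₁ n₂ δ)
        + 8 * ENNReal.ofReal δ * volume (ball (0 : E3) 6)) := by
  set E := transverseDirections u n₁ n₂ δ with hE
  set V := wedgeCylinder u n₁ n₂ 1 (Ico (-1) 1) with hV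
  set X := {w ∈ V | 1 / 2 ≤ ‖w - inner ℝ u w • u‖} with hX
  have hstep1 : {w ∈ ball (0 : E3) R | 0 < inner ℝ n₁ w * inner ℝ n₂ w} ⊆ R • V := by
    have hscale := wedgeCylinder_scale (u := u) (n₁ := n₁) (n₂ := n₂) 1 hR (Ico (-R) R)
    have e : (fun t : ℝ => R * t) ⁻¹' Ico (-R) R = Ico (-1) 1 := by
      ext t
      simp only [mem_preimage, mem_Ico]
      constructor <;> rintro ⟨h1, h2⟩ <;> constructor <;> nlinarith
    rw [e] at hscale
    rw [hV, ← hscale]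
    rintro w ⟨hw, hw'⟩
    rw [mem_ball_zero_iff] at hw
    have h3 : ‖w - inner ℝ u w • u‖ ≤ ‖w‖ := by
      rw [← sq_le_sq₀ (norm_nonneg _) (norm_nonneg _), norm_sub_sq_real, norm_smul,
        inner_smul_right, real_inner_comm, hu, mul_one, Real.norm_eq_abs, sq_abs]
      nlinarith [sq_nonneg (inner ℝ u w : ℝ)]
    have h4 : |inner ℝ u w| ≤ ‖w‖ := by simpa [hu] using abs_real_inner_le_norm u w
    rw [abs_le] at h4
    exact ⟨hw', by linarith, by linarith, by linarith⟩
  have hslab : ∀ n : E3, n ≠ 0 → volume {w ∈ ball (0 : E3) 2 | |inner ℝ n w| < 2 * δ * ‖n‖} ≤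
      ENNReal.ofReal (2 * δ) * volume (ball (0 : E3) 6) := by
    intro n hn
    have hn' : 0 < ‖n‖ := norm_pos_iff.2 hn
    refine le_trans (measure_mono ?_) (volume_slab_le (v := ‖n‖⁻¹ • n)
      (by rw [norm_smul, norm_inv, norm_norm, inv_mul_cancel₀ hn'.ne']) (by linarith))
    rintro w ⟨hw, hw'⟩
    refine ⟨hw, ?_⟩
    rw [inner_smul_left, abs_mul, conj_trivial, abs_of_pos (inv_pos.2 hn'), inv_mul_lt_iff₀ hn']
    linarith
  -- The spherical measure is 3 times the volume of the unit cone; this factor is given away, and 8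
  -- comes from the scaling by 2.
  have hcone : volume ((2 : ℝ) • (Ioo (0 : ℝ) 1 • (Subtype.val '' E : Set E3))) ≤
      8 * (volume : Measure E3).toSphere E := by
    rw [volume_smul_E3 2 zero_le_two,
      Measure.toSphere_apply' _ (measurableSet_transverseDirections δ), finrank_E3,
      show (2 : ℝ) ^ 3 = ((8 : ℕ) : ℝ) by norm_num, ENNReal.ofReal_natCast]
    push_cast
    gcongr
    exact le_mul_of_one_le_left zero_le (by norm_num)
  have hstep2 : X ⊆ ((2 : ℝ) • (Ioo (0 : ℝ) 1 • (Subtype.val '' E : Set E3)) ∪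
      {w ∈ ball (0 : E3) 2 | |inner ℝ n₁ w| < 2 * δ * ‖n₁‖}) ∪
      {w ∈ ball (0 : E3) 2 | |inner ℝ n₂ w| < 2 * δ * ‖n₂‖} := by
    rintro w ⟨hw, hw'⟩
    have hwb : w ∈ ball (0 : E3) 2 := wedgeCylinder_subset_ball hu hw
    have hw2 : ‖w‖ < 2 := mem_ball_zero_iff.1 hwb
    by_cases hb1 : |inner ℝ n₁ w| < 2 * δ * ‖n₁‖
    · exact Or.inl (Or.inr ⟨hwb, hb1⟩)
    by_cases hb2 : |inner ℝ n₂ w| < 2 * δ * ‖n₂‖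
    · exact Or.inr ⟨hwb, hb2⟩
    left; left
    have hw0 : w ≠ 0 := by
      rintro rfl
      have := hw.1
      simp at this
    have hwn : 0 < ‖w‖ := norm_pos_iff.2 hw0
    have hdm : ‖w‖⁻¹ • w ∈ sphere (0 : E3) 1 := by
      rw [mem_sphere_zero_iff_norm, norm_smul, norm_inv, norm_norm, inv_mul_cancel₀ hwn.ne']
    have hbd : ∀ n : E3, ¬ |inner ℝ n w| < 2 * δ * ‖n‖ → δ * ‖n‖ ≤ |inner ℝ n (‖w‖⁻¹ • w)| := by
      intro n hn
      rw [not_lt] at hn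
      rw [inner_smul_right, abs_mul, abs_of_pos (inv_pos.2 hwn), le_inv_mul_iff₀ hwn]
      have : 0 ≤ δ * ‖n‖ := by positivity
      nlinarith
    refine ⟨(2⁻¹ : ℝ) • w, ⟨‖w‖ / 2, ⟨by positivity, ?_⟩, ‖w‖⁻¹ • w, ⟨⟨_, hdm⟩, ?_, rfl⟩, ?_⟩, ?_⟩
    · linarith
    · refine ⟨?_, hbd n₁ hb1, hbd n₂ hb2, ?_⟩
      · simp only [inner_smul_right]
        have e3 : ‖w‖⁻¹ * inner ℝ n₁ w * (‖w‖⁻¹ * inner ℝ n₂ w) =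
          ‖w‖⁻¹ ^ 2 * (inner ℝ n₁ w * inner ℝ n₂ w) := by ring
        rw [e3]
        exact mul_pos (by positivity) hw.1
      · rw [norm_projAlong_eq hu, hu]
        simp only [inner_smul_right]
        rw [mul_smul, ← smul_sub, norm_smul, norm_inv, norm_norm, le_inv_mul_iff₀ hwn]
        linarith
    · simp only [smul_smul]
      congr 1
      field_simp
    · simp [smul_smul]
  have hXvol : volume X ≤ 8 * (volume : Measure E3).toSphere E +
      4 * ENNReal.ofReal δ * volume (ball (0 : E3) 6) := by
    refine (measure_mono hstep2).trans ((measure_union_le _ _).trans ?_)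
    refine (add_le_add (measure_union_le _ _) (hslab n₂ hn₂)).trans ?_
    refine (add_le_add (add_le_add hcone (hslab n₁ hn₁)) le_rfl).trans ?_
    rw [ENNReal.ofReal_mul zero_le_two, ENNReal.ofReal_ofNat, add_assoc, ← two_mul, ← mul_assoc,
      ← mul_assoc]
    norm_num
  calc _ ≤ volume (R • V) := measure_mono hstep1
    _ = ENNReal.ofReal (R ^ 3) * volume V := volume_smul_E3 R hR.le V
    _ ≤ ENNReal.ofReal (R ^ 3) * (2 * volume X) := by
        gcongr
        exact volume_wedgeCylinder_le hu h₁ h₂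
    _ ≤ ENNReal.ofReal (R ^ 3) * (2 * (8 * (volume : Measure E3).toSphere E +
      4 * ENNReal.ofReal δ * volume (ball (0 : E3) 6))) := by gcongr
    _ = _ := by
        rw [mul_add, ← mul_assoc 2, ← mul_assoc 2, ← mul_assoc 2]
        norm_num

/-- The volume of a double wedge in a ball is controlled by the measure of its transverse
directions, up to a small error. -/
theorem volume_wedge_le (hu : u ≠ 0) (h₁ : inner ℝ n₁ u = 0)
    (h₂ : inner ℝ n₂ u = 0) (hn₁ : n₁ ≠ 0) (hn₂ : n₂ ≠ 0) {δ : ℝ} (hδ : 0 < δ) {R : ℝ}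
    (hR : 0 < R) :
    volume {w ∈ ball (0 : E3) R | 0 < inner ℝ n₁ w * inner ℝ n₂ w} ≤
      ENNReal.ofReal (R ^ 3) * (16 * (volume : Measure E3).toSphere (transverseDirections u n₁ n₂ δ)
        + 8 * ENNReal.ofReal δ * volume (ball (0 : E3) 6)) := by
  have hu' : 0 < ‖u‖ := norm_pos_iff.2 hu
  rw [← transverseDirections_smul (inv_pos.2 hu')]
  exact volume_wedge_le_of_norm_eq_one
    (by rw [norm_smul, norm_inv, norm_norm, inv_mul_cancel₀ hu'.ne'])
    (by rw [inner_smul_right, h₁, mul_zero]) (by rw [inner_smul_right, h₂, mul_zero]) hn₁ hn₂ hδ hR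

end wedge

end volumes

/-! ### Edges with two adjacent triangles -/

open Classical in
/-- The edge `e = {a, b}` of `K` is adjacent to the two triangles `a b (c 0)` and `a b (c 1)`. -/
structure IsInteriorEdge (K : Geometry.SimplicialComplex ℝ E3) (e : Finset E3) (a b : E3)
    (c : Fin 2 → E3) : Prop where
  eq_pair : e = {a, b}
  ne : a ≠ b
  ne_apex : c 0 ≠ c 1
  mem_faces : ∀ i, ({a, b, c i} : Finset E3) ∈ K.faces
  ne_left : ∀ i, a ≠ c i
  ne_right : ∀ i, b ≠ c i

theorem ne_of_card_triple [DecidableEq E3] {a b c : E3} (h : ({a, b, c} : Finset E3).card = 3) :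
    a ≠ b ∧ a ≠ c ∧ b ≠ c := by
  refine ⟨?_, ?_, ?_⟩ <;> rintro rfl
  · have := Finset.card_le_two (a := a) (b := c)
    simp only [Finset.mem_insert, Finset.mem_singleton, true_or, Finset.insert_eq_of_mem] at h
    omega
  · have := Finset.card_le_two (a := b) (b := a)
    simp only [Finset.mem_insert, Finset.mem_singleton, or_true, Finset.insert_eq_of_mem] at h
    omega
  · have := Finset.card_le_two (a := a) (b := b)
    simp only [Finset.mem_singleton, Finset.insert_eq_of_mem] at h
    omega

theorem IsFrontBackEdge.exists_isInteriorEdge {K : Geometry.SimplicialComplex ℝ E3} {V : E3}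
    {e : Finset E3} (h : IsFrontBackEdge K V e) : ∃ a b c, IsInteriorEdge K e a b c := by
  classical
  obtain ⟨a, b, c₁, c₂, he, hc, h1, h1c, h2, h2c, -⟩ := h
  have n1 := ne_of_card_triple h1c
  have n2 := ne_of_card_triple h2c
  refine ⟨a, b, ![c₁, c₂], ⟨by convert he, n1.1, by simpa using hc, ?_, ?_, ?_⟩⟩
  · intro i; fin_cases i
    · exact h1
    · exact h2
  · intro i; fin_cases i
    · exact n1.2.1
    · exact n2.2.1
  · intro i; fin_cases i
    · exact n1.2.2
    · exact n2.2.2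

namespace IsInteriorEdge

variable {K : Geometry.SimplicialComplex ℝ E3} {e : Finset E3} {a b : E3} {c : Fin 2 → E3}

open Classical in
theorem card_eq (h : IsInteriorEdge K e a b c) (i : Fin 2) :
    ({a, b, c i} : Finset E3).card = 3 :=
  Finset.card_eq_three.2 ⟨a, b, c i, h.ne, h.ne_left i, h.ne_right i, rfl⟩

open Classical in
theorem subset_triangle (h : IsInteriorEdge K e a b c) (i : Fin 2) :
    e ⊆ ({a, b, c i} : Finset E3) := by
  rw [h.eq_pair]
  intro x hx
  simp only [Finset.mem_insert, Finset.mem_singleton] at hx ⊢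
  tauto

theorem mem_meshEdges (h : IsInteriorEdge K e a b c) : e ∈ meshEdges K := by
  classical
  refine ⟨K.down_closed (h.mem_faces 0) (h.subset_triangle 0) ?_, ?_⟩
  · rw [h.eq_pair]; exact ⟨a, by simp⟩
  · rw [h.eq_pair, Finset.card_pair h.ne]

open Classical in
theorem eq_triangle (h : IsInteriorEdge K e a b c) {n : ℕ} (hK : IsTriangleMesh K n)
    {T : Finset E3} (hT : T ∈ K.faces) (hT3 : T.card = 3) (heT : e ⊆ T) :
    ∃ i, T = {a, b, c i} := by
  by_contra! hne
  have hle := hK.adjacent_le_two e h.mem_meshEdges.1 h.mem_meshEdges.2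
  have h01 : ({a, b, c 0} : Finset E3) ≠ {a, b, c 1} := by
    intro heq
    have h1 : c 0 ∈ ({a, b, c 1} : Finset E3) := by rw [← heq]; simp
    simp only [Finset.mem_insert, Finset.mem_singleton] at h1
    rcases h1 with h1 | h1 | h1
    · exact h.ne_left 0 h1.symm
    · exact h.ne_right 0 h1.symm
    · exact h.ne_apex h1
  have hsub : ({T, {a, b, c 0}, {a, b, c 1}} : Set (Finset E3)) ⊆
      {T ∈ K.faces | T.card = 3 ∧ e ⊆ T} := by
    rintro T' (rfl | rfl | rfl)
    · exact ⟨hT, hT3, heT⟩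
    · exact ⟨h.mem_faces 0, h.card_eq 0, h.subset_triangle 0⟩
    · exact ⟨h.mem_faces 1, h.card_eq 1, h.subset_triangle 1⟩
  have h3 := (encard_le_encard hsub).trans hle
  rw [encard_eq_three.2 ⟨_, _, _, hne 0, hne 1, h01, rfl⟩] at h3
  exact absurd h3 (by decide)

theorem apex_eq (h : IsInteriorEdge K e a b c) {n : ℕ} (hK : IsTriangleMesh K n)
    [DecidableEq E3] {x : E3} (hxa : x ≠ a) (hxb : x ≠ b)
    (hT : ({a, b, x} : Finset E3) ∈ K.faces) : ∃ i, x = c i := by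
  obtain ⟨i, hi⟩ := h.eq_triangle hK hT
    (Finset.card_eq_three.2 ⟨a, b, x, h.ne, hxa.symm, hxb.symm, rfl⟩)
    (by rw [h.eq_pair]; intro y hy; simp only [Finset.mem_insert, Finset.mem_singleton] at hy ⊢; tauto)
  refine ⟨i, ?_⟩
  have h1 : x ∈ ({a, b, x} : Finset E3) := by simp
  rw [hi] at h1
  simp only [Finset.mem_insert, Finset.mem_singleton] at h1
  tauto

/-- From a viewpoint that sees a front face and a back face next to the edge, both faces are on the
same side of the edge. -/
theorem inner_mul_inner_pos (h : IsInteriorEdge K e a b c) {n : ℕ} (hK : IsTriangleMesh K n)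
    {V : E3} (hV : IsFrontBackEdge K V e) :
    0 < inner ℝ (triNormal a b (c 0)) (V - a) * inner ℝ (triNormal a b (c 1)) (V - a) := by
  classical
  obtain ⟨a', b', c₁, c₂, he, hc, h1, h1c, h2, h2c, hp, hn⟩ := hV
  have n1 := ne_of_card_triple h1c
  have n2 := ne_of_card_triple h2c
  -- Normals are orthogonal to the edge, so either endpoint may serve as base point. With both
  -- normals oriented by the same order of `a` and `b`, the opposite signs of front and back become
  -- equal signs.
  have hVb : ∀ x, inner ℝ (triNormal a b x) (V - b) = inner ℝ (triNormal a b x) (V - a) := by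
    intro x
    rw [← sub_sub_sub_cancel_right V b a, inner_sub_right, inner_triNormal_edge, sub_zero]
  have hsame : ∀ i j : Fin 2, c i ≠ c j →
      0 < inner ℝ (triNormal a b (c i)) (V - a) * inner ℝ (triNormal a b (c j)) (V - a) →
      0 < inner ℝ (triNormal a b (c 0)) (V - a) * inner ℝ (triNormal a b (c 1)) (V - a) := by
    intro i j hij hpos
    fin_cases i <;> fin_cases j
    · exact absurd rfl hij
    · exact hpos
    · rw [mul_comm]; exact hpos
    · exact absurd rfl hij
  have hpair : ({a', b'} : Set E3) = {a, b} := by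
    rw [h.eq_pair] at he
    have := congrArg (fun s : Finset E3 => (s : Set E3)) he
    simp only [Finset.coe_pair] at this
    exact this.symm
  rcases pair_eq_pair_iff.1 hpair with ⟨rfl, rfl⟩ | ⟨rfl, rfl⟩
  · obtain ⟨i, rfl⟩ := h.apex_eq hK n1.2.1.symm n1.2.2.symm h1
    obtain ⟨j, rfl⟩ := h.apex_eq hK n2.2.1.symm n2.2.2.symm h2
    rw [triNormal_swap, inner_neg_left, hVb] at hn
    exact hsame i j hc (mul_pos hp (by linarith))
  · rw [Finset.insert_comm] at h1 h2
    obtain ⟨i, rfl⟩ := h.apex_eq hK n1.2.2.symm n1.2.1.symm h1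
    obtain ⟨j, rfl⟩ := h.apex_eq hK n2.2.2.symm n2.2.1.symm h2
    rw [triNormal_swap, inner_neg_left, hVb] at hp
    exact hsame i j hc (mul_pos_of_neg_of_neg (by linarith) hn)

theorem starNbhd_subset (h : IsInteriorEdge K e a b c) {n : ℕ} (hK : IsTriangleMesh K n) :
    K.space ∩ starNbhd K e ⊆ ⋃ i, convexHull ℝ {a, b, c i} := by
  classical
  rintro x ⟨hx, hxe⟩
  obtain ⟨T, hT, hT3, hxT⟩ := exists_triangle_of_mem_space hK hx
  obtain ⟨i, rfl⟩ := h.eq_triangle hK hT hT3 (subset_of_mem_starNbhd hxe hT hxT)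
  exact mem_iUnion.2 ⟨i, by simpa using hxT⟩

section normals

variable {n : ℕ} {S : Set E3} {α β : ℝ}

theorem triNormal_ne_zero (h : IsInteriorEdge K e a b c) (f : K.space ≃ₜ S) (hn : 0 < n)
    (hβ : 0 < β) (hdist : DistanceHypothesis K n β f) (i : Fin 2) :
    triNormal a b (c i) ≠ 0 := by
  classical
  intro h0
  have h1 := minHeight_pos f hn hβ hdist (h.mem_faces i) (h.card_eq i)
  have h2 := minHeight_mul_le (T := {a, b, c i}) (by simp) (by simp) (by simp) h.ne (h.ne_left i)
    (h.ne_right i)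
  rw [h0, norm_zero] at h2
  have := mul_pos h1 (norm_pos_iff.2 (sub_ne_zero.2 (h.ne_left i).symm))
  linarith

/-- From a transverse direction, the surface has a silhouette near the edge. -/
theorem exists_silhouette (h : IsInteriorEdge K e a b c) (hS : IsCompact S) (f : K.space ≃ₜ S)
    (hn : 0 < n) (hK : IsTriangleMesh K n) (hβ : 0 < β) (hedge : EdgeLengthHypothesis K n α)
    (hdist : DistanceHypothesis K n β f) {d : sphere (0 : E3) 1}
    (hd : d ∈ transverseDirections (b - a) (triNormal a b (c 0)) (triNormal a b (c 1))
      (12 * β / √(n : ℝ))) :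
    ∃ G : Set E3, MeasurableSet G ∧
      ENNReal.ofReal (α / (12 * √(n : ℝ))) ≤ (Measure.hausdorffMeasure 1 : Measure E3) G ∧
      ∀ y ∈ G, ∃ p ∈ extendMap f '' (K.space ∩ starNbhd K e),
        p ∈ silhouetteSet S (.atInfinity d) ∧ projAlong d p = y := by
  classical
  have hsqrt : 0 < √(n : ℝ) := Real.sqrt_pos.2 (by exact_mod_cast hn)
  have hcoe : ∀ i, convexHull ℝ {a, b, c i} = convexHull ℝ (({a, b, c i} : Finset E3) : Set E3) :=
    fun i => by simp
  have hpos := fun i => minHeight_pos f hn hβ hdist (h.mem_faces i) (h.card_eq i)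
  -- The choice of δ makes 12 ε = δ h an equality.
  obtain ⟨G, hG, hGlen, hGsub⟩ := exists_silhouette_near_edge f hS d (a := a) (b := b) (c := c)
    (h := fun i => minHeight {a, b, c i}) (δ := 12 * β / √(n : ℝ))
    (ε := fun i => β * minHeight {a, b, c i} / √(n : ℝ)) (by positivity) h.ne
    (fun i => div_pos (mul_pos hβ (hpos i)) hsqrt)
    (fun i => le_of_eq (by ring))
    (fun i => minHeight_mul_le (by simp) (by simp) (by simp) h.ne (h.ne_left i) (h.ne_right i))
    (fun i => by
      have := minHeight_mul_le (T := {a, b, c i}) (a := b) (b := a) (c := c i) (by simp) (by simp)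
        (by simp) h.ne.symm (h.ne_right i) (h.ne_left i)
      rwa [triNormal_swap, norm_neg] at this)
    (fun i => by
      rw [← dist_eq_norm]
      exact minHeight_le_dist (by simp) (by simp) h.ne.symm)
    (h.triNormal_ne_zero f hn hβ hdist)
    (fun i => by
      fin_cases i
      · exact hd.2.1
      · exact hd.2.2.1)
    hd.1 (isOpen_starNbhd hK.finite e)
    (fun i => by
      rw [hcoe]
      exact Geometry.SimplicialComplex.convexHull_subset_space (h.mem_faces i))
    (fun i x hx => by
      rw [hcoe] at hx
      exact dist_extendMap_lt f hdist (h.mem_faces i) (h.card_eq i) hx)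
    (h.starNbhd_subset hK)
    (fun i => by
      rw [h.eq_pair]
      exact triangle_subset_starNbhd_union (h.mem_faces i))
  refine ⟨G, hG, le_trans (ENNReal.ofReal_le_ofReal ?_) hGlen, hGsub⟩
  -- Of the length of the edge, the projection keeps at least 1/4 and the middle third of the slices
  -- 1/3, whence α/(12√n).
  have h1 := hd.2.2.2
  have h2 := hedge a b h.ne (h.eq_pair ▸ h.mem_meshEdges.1)
  rw [dist_comm, dist_eq_norm] at h2
  have h3 : α / (12 * √(n : ℝ)) = α / √(n : ℝ) / 12 := by rw [mul_comm, div_div]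
  rw [h3]
  linarith

end normals

end IsInteriorEdge

/-! ### The silhouette of the surface from all directions -/

section sum

variable {K : Geometry.SimplicialComplex ℝ E3} {n : ℕ} {S : Set E3} {α β : ℝ}
  {ι : Type*} [Fintype ι] {edge : ι → Finset E3} {a b : ι → E3} {c : ι → Fin 2 → E3}

/-- The pieces of the silhouette near the edges that are seen transversely from direction `d`
overlap at most three times. -/
theorem sum_indicator_transverseDirections_le (hS : IsCompact S) (f : K.space ≃ₜ S) (hn : 0 < n)
    (hK : IsTriangleMesh K n) (hβ : 0 < β) (hedge : EdgeLengthHypothesis K n α)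
    (hdist : DistanceHypothesis K n β f) (hinj : Function.Injective edge)
    (h : ∀ j, IsInteriorEdge K (edge j) (a j) (b j) (c j)) (d : sphere (0 : E3) 1) :
    ∑ j, (transverseDirections (b j - a j) (triNormal (a j) (b j) (c j 0))
      (triNormal (a j) (b j) (c j 1)) (12 * β / √(n : ℝ))).indicator
        (fun _ => ENNReal.ofReal (α / (12 * √(n : ℝ)))) d ≤ 3 * silhouetteLength S d := by
  classical
  set D := fun j => transverseDirections (b j - a j) (triNormal (a j) (b j) (c j 0))
      (triNormal (a j) (b j) (c j 1)) (12 * β / √(n : ℝ)) with hD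
  have hG : ∀ j, ∃ G : Set E3, MeasurableSet G ∧
      (D j).indicator (fun _ => ENNReal.ofReal (α / (12 * √(n : ℝ)))) d ≤
        (Measure.hausdorffMeasure 1 : Measure E3) G ∧
      ∀ y ∈ G, ∃ p ∈ extendMap f '' (K.space ∩ starNbhd K (edge j)),
        p ∈ silhouetteSet S (.atInfinity d) ∧ projAlong d p = y := by
    intro j
    by_cases hj : d ∈ D j
    · rw [indicator_of_mem hj]
      exact (h j).exists_silhouette hS f hn hK hβ hedge hdist hj
    · rw [indicator_of_notMem hj]
      exact ⟨∅, MeasurableSet.empty, zero_le, by simp⟩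
  choose G hGm hGlen hGsub using hG
  have hpt : ∀ y, ∑ j, (G j).indicator (1 : E3 → ℝ≥0∞) y ≤
      3 * ((({p ∈ silhouetteSet S (.atInfinity d) | projAlong d p = y}).encard : ℕ∞) : ℝ≥0∞) := by
    intro y
    set Y := {p ∈ silhouetteSet S (.atInfinity d) | projAlong d p = y} with hY
    -- If infinitely many silhouette points project to `y`, the right-hand side is infinite.
    -- Otherwise each piece through `y` selects one of these points, and a point is selected by at
    -- most three edges.
    by_cases hfin : Y.Finite
    swap
    · rw [Set.Infinite.encard_eq hfin]
      simp
    have hsum : ∑ j, (G j).indicator (1 : E3 → ℝ≥0∞) y =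
        ((Finset.univ.filter fun j => y ∈ G j).card : ℝ≥0∞) := by
      rw [Finset.card_filter]
      push_cast
      exact Finset.sum_congr rfl fun j _ => by simp [indicator_apply]
    let near : E3 → Finset ι := fun p =>
      Finset.univ.filter fun j => p ∈ extendMap f '' (K.space ∩ starNbhd K (edge j))
    have hnear : ∀ p, (near p).card ≤ 3 := by
      intro p
      rcases (near p).eq_empty_or_nonempty with h0 | ⟨j₀, hj₀⟩
      · rw [h0]; simp
      obtain ⟨x, hx, rfl⟩ := (Finset.mem_filter.1 hj₀).2
      have h1 : (((near (extendMap f x)).image edge : Finset (Finset E3)) : Set (Finset E3)) ⊆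
          {e ∈ meshEdges K | x ∈ starNbhd K e} := by
        intro e he
        obtain ⟨j, hj, rfl⟩ := Finset.mem_image.1 (Finset.mem_coe.1 he)
        obtain ⟨x', hx', hxx'⟩ := (Finset.mem_filter.1 hj).2
        have := injOn_extendMap f hx'.1 hx.1 hxx'
        subst this
        exact ⟨(h j).mem_meshEdges, hx'.2⟩
      have h2 := (encard_le_encard h1).trans (encard_edges_starNbhd_le hK hx.1)
      rw [encard_coe_eq_coe_finsetCard, Finset.card_image_of_injective _ hinj] at h2
      exact_mod_cast h2
    have hsub : (Finset.univ.filter fun j => y ∈ G j) ⊆ hfin.toFinset.biUnion near := by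
      intro j hj
      obtain ⟨p, hp, hps, hpy⟩ := hGsub j y (Finset.mem_filter.1 hj).2
      rw [Finset.mem_biUnion]
      exact ⟨p, hfin.mem_toFinset.2 ⟨hps, hpy⟩, Finset.mem_filter.2 ⟨Finset.mem_univ _, hp⟩⟩
    have hcard := (Finset.card_le_card hsub).trans
      (Finset.card_biUnion_le_card_mul _ _ 3 fun p _ => hnear p)
    rw [hsum, hfin.encard_eq_coe_toFinset_card, mul_comm]
    exact_mod_cast hcard
  calc ∑ j, (D j).indicator (fun _ => ENNReal.ofReal (α / (12 * √(n : ℝ)))) d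
      ≤ ∑ j, (Measure.hausdorffMeasure 1 : Measure E3) (G j) :=
        Finset.sum_le_sum fun j _ => hGlen j
    _ = ∑ j, ∫⁻ y, (G j).indicator (1 : E3 → ℝ≥0∞) y ∂(Measure.hausdorffMeasure 1 : Measure E3) := by
        simp_rw [lintegral_indicator_one (hGm _)]
    _ = ∫⁻ y, ∑ j, (G j).indicator (1 : E3 → ℝ≥0∞) y ∂(Measure.hausdorffMeasure 1 : Measure E3) :=
        (lintegral_finsetSum _ fun j _ => measurable_one.indicator (hGm j)).symm
    _ ≤ ∫⁻ y, 3 * ((({p ∈ silhouetteSet S (.atInfinity d) | projAlong d p = y}).encard : ℕ∞) :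
          ℝ≥0∞) ∂(Measure.hausdorffMeasure 1 : Measure E3) := lintegral_mono hpt
    _ = 3 * silhouetteLength S d := by
        rw [silhouetteLength, lintegral_const_mul' _ _ (by norm_num)]

/-- Integrate the pointwise overlap bound over all directions and divide by α/(12√n); the constant
is 36 = 3 · 12. -/
theorem sum_toSphere_transverseDirections_le (hS : IsCompact S) (f : K.space ≃ₜ S) (hn : 0 < n)
    (hK : IsTriangleMesh K n) (hα : 0 < α) (hβ : 0 < β) (hedge : EdgeLengthHypothesis K n α)
    (hdist : DistanceHypothesis K n β f) (hinj : Function.Injective edge)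
    (h : ∀ j, IsInteriorEdge K (edge j) (a j) (b j) (c j)) :
    ∑ j, (volume : Measure E3).toSphere (transverseDirections (b j - a j)
      (triNormal (a j) (b j) (c j 0)) (triNormal (a j) (b j) (c j 1)) (12 * β / √(n : ℝ))) ≤
      ENNReal.ofReal √(n : ℝ) * (ENNReal.ofReal (36 / α) *
        ∫⁻ d, silhouetteLength S d ∂((volume : Measure E3).toSphere)) := by
  have hsqrt : 0 < √(n : ℝ) := Real.sqrt_pos.2 (by exact_mod_cast hn)
  set Λ := ∫⁻ d, silhouetteLength S d ∂((volume : Measure E3).toSphere)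
  set q := ENNReal.ofReal (α / (12 * √(n : ℝ))) with hq
  have h1 : q * ∑ j, (volume : Measure E3).toSphere (transverseDirections (b j - a j)
      (triNormal (a j) (b j) (c j 0)) (triNormal (a j) (b j) (c j 1)) (12 * β / √(n : ℝ))) ≤
      3 * Λ := by
    rw [Finset.mul_sum]
    calc _ = ∑ j, ∫⁻ d, (transverseDirections (b j - a j) (triNormal (a j) (b j) (c j 0))
            (triNormal (a j) (b j) (c j 1)) (12 * β / √(n : ℝ))).indicator (fun _ => q) d
              ∂((volume : Measure E3).toSphere) := by
          refine Finset.sum_congr rfl fun j _ => ?_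
          rw [lintegral_indicator_const (measurableSet_transverseDirections _)]
      _ = ∫⁻ d, ∑ j, (transverseDirections (b j - a j) (triNormal (a j) (b j) (c j 0))
            (triNormal (a j) (b j) (c j 1)) (12 * β / √(n : ℝ))).indicator (fun _ => q) d
              ∂((volume : Measure E3).toSphere) :=
          (lintegral_finsetSum _ fun j _ =>
            measurable_const.indicator (measurableSet_transverseDirections _)).symm
      _ ≤ ∫⁻ d, 3 * silhouetteLength S d ∂((volume : Measure E3).toSphere) :=
          lintegral_mono fun d =>
            sum_indicator_transverseDirections_le hS f hn hK hβ hedge hdist hinj h d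
      _ = 3 * Λ := lintegral_const_mul' _ _ (by norm_num)
  have hinv : ENNReal.ofReal (12 * √(n : ℝ) / α) * q = 1 := by
    rw [hq, ← ENNReal.ofReal_mul (by positivity), ENNReal.ofReal_eq_one]
    field_simp
  calc _ = ENNReal.ofReal (12 * √(n : ℝ) / α) * q * ∑ j, (volume : Measure E3).toSphere
        (transverseDirections (b j - a j) (triNormal (a j) (b j) (c j 0))
          (triNormal (a j) (b j) (c j 1)) (12 * β / √(n : ℝ))) := by rw [hinv, one_mul]
    _ ≤ ENNReal.ofReal (12 * √(n : ℝ) / α) * (3 * Λ) := by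
        rw [mul_assoc]; gcongr
    _ = _ := by
        rw [← mul_assoc, ← mul_assoc]
        congr 1
        rw [← ENNReal.ofReal_ofNat, ← ENNReal.ofReal_mul (by positivity),
          ← ENNReal.ofReal_mul (by positivity)]
        congr 1
        ring

end sum

/-! ### The expected number of silhouette edges -/

theorem isOpen_isFrontBackEdge (K : Geometry.SimplicialComplex ℝ E3) (e : Finset E3) :
    IsOpen {V | IsFrontBackEdge K V e} := by
  classical
  have h1 : {V | IsFrontBackEdge K V e} = ⋃ (a : E3) (b : E3) (c₁ : E3) (c₂ : E3)
      (_ : e = {a, b} ∧ c₁ ≠ c₂ ∧ ({a, b, c₁} : Finset E3) ∈ K.faces ∧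
        ({a, b, c₁} : Finset E3).card = 3 ∧ ({a, b, c₂} : Finset E3) ∈ K.faces ∧
        ({a, b, c₂} : Finset E3).card = 3),
      {V | 0 < inner ℝ (triNormal a b c₁) (V - a)} ∩
        {V | inner ℝ (triNormal b a c₂) (V - b) < 0} := by
    ext V
    simp only [IsFrontBackEdge, mem_ofPred_eq, mem_iUnion, mem_inter_iff, exists_prop]
    refine exists_congr fun a => exists_congr fun b => exists_congr fun c₁ =>
      exists_congr fun c₂ => ?_
    constructor
    · rintro ⟨h1, h2, h3, h4, h5, h6, h7, h8⟩
      exact ⟨⟨by convert h1, h2, by convert h3, by convert h4, by convert h5, by convert h6⟩, h7, h8⟩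
    · rintro ⟨⟨h1, h2, h3, h4, h5, h6⟩, h7, h8⟩
      exact ⟨by convert h1, h2, by convert h3, by convert h4, by convert h5, by convert h6, h7, h8⟩
  rw [h1]
  refine isOpen_iUnion fun a => isOpen_iUnion fun b => isOpen_iUnion fun c₁ =>
    isOpen_iUnion fun c₂ => isOpen_iUnion fun _ => ?_
  exact (isOpen_lt continuous_const (by fun_prop)).inter (isOpen_lt (by fun_prop) continuous_const)

/-! ### Degenerate viewpoints are negligible; measurability of the complexity -/

theorem affineSpan_triangle_ne_top {T : Finset E3} (hT3 : T.card = 3) :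
    affineSpan ℝ (T : Set E3) ≠ ⊤ := by
  classical
  intro h
  have h1 := finrank_vectorSpan_image_finset_le ℝ (id : E3 → E3) T (n := 2) hT3
  rw [Finset.image_id, ← direction_affineSpan, h, AffineSubspace.direction_top, finrank_top,
    finrank_E3] at h1
  omega

-- Degenerate silhouette edges occur only for viewpoints in one of the finitely many planes of
-- faces, a null set. Elsewhere the count is a finite sum of measurable indicators.
open Classical in
theorem silhouetteComplexity_ae_eq {K : Geometry.SimplicialComplex ℝ E3} {n : ℕ}
    (hK : IsTriangleMesh K n) :
    silhouetteComplexity K =ᵐ[volume] fun V => ∑ e ∈ (finite_meshEdges hK.finite).toFinset,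
      {V | IsBoundaryEdge K e ∨ IsFrontBackEdge K V e}.indicator (1 : E3 → ℝ≥0∞) V := by
  have hfin : {T ∈ K.faces | T.card = 3}.Finite := hK.finite.subset (sep_subset _ _)
  have hnull : volume (⋃ T ∈ {T ∈ K.faces | T.card = 3}, (affineSpan ℝ (T : Set E3) : Set E3)) = 0 :=
    (measure_biUnion_null_iff hfin.countable).2 fun T hT =>
      Measure.addHaar_affineSubspace _ _ (affineSpan_triangle_ne_top hT.2)
  filter_upwards [compl_mem_ae_iff.2 hnull] with V hV
  have h1 : meshSilhouette K V = (((finite_meshEdges hK.finite).toFinset.filter fun e =>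
      IsBoundaryEdge K e ∨ IsFrontBackEdge K V e : Finset (Finset E3)) : Set (Finset E3)) := by
    ext e
    rw [Finset.mem_coe, Finset.mem_filter, Finite.mem_toFinset]
    constructor
    · rintro ⟨he, he2, h | h | ⟨⟨T, hT, hT3, -, hVT⟩, -⟩⟩
      · exact ⟨⟨he, he2⟩, Or.inl h⟩
      · exact ⟨⟨he, he2⟩, Or.inr h⟩
      · exact absurd (mem_biUnion (show T ∈ {T ∈ K.faces | T.card = 3} from ⟨hT, hT3⟩) hVT) hV
    · rintro ⟨⟨he, he2⟩, h | h⟩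
      · exact ⟨he, he2, Or.inl h⟩
      · exact ⟨he, he2, Or.inr (Or.inl h)⟩
  rw [silhouetteComplexity, h1, encard_coe_eq_coe_finsetCard, Finset.card_filter]
  rw [ENat.toENNReal_coe, Nat.cast_sum]
  exact Finset.sum_congr rfl fun e _ => by simp [indicator_apply]

theorem measurableSet_boundary_or_frontBack (K : Geometry.SimplicialComplex ℝ E3)
    (e : Finset E3) : MeasurableSet {V | IsBoundaryEdge K e ∨ IsFrontBackEdge K V e} :=
  (MeasurableSet.const (IsBoundaryEdge K e)).union (isOpen_isFrontBackEdge K e).measurableSet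

theorem aemeasurable_silhouetteComplexity {K : Geometry.SimplicialComplex ℝ E3} {n : ℕ}
    (hK : IsTriangleMesh K n) : AEMeasurable (silhouetteComplexity K) volume :=
  ⟨_, Finset.measurable_fun_sum _ fun e _ =>
    measurable_one.indicator (measurableSet_boundary_or_frontBack K e), silhouetteComplexity_ae_eq hK⟩

theorem silhouetteComplexity_le {K : Geometry.SimplicialComplex ℝ E3} {n : ℕ}
    (hK : IsTriangleMesh K n) (V : E3) : silhouetteComplexity K V ≤ 3 * n := by
  have h1 : meshSilhouette K V ⊆ meshEdges K := fun e he => ⟨he.1, he.2.1⟩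
  have h2 : (meshSilhouette K V).encard ≤ ((3 * n : ℕ) : ℕ∞) := by
    refine (encard_le_encard h1).trans ?_
    rw [← (finite_meshEdges hK.finite).cast_ncard_eq]
    exact_mod_cast ncard_meshEdges_le hK
  calc silhouetteComplexity K V ≤ (((3 * n : ℕ) : ℕ∞) : ℝ≥0∞) := ENat.toENNReal_le.2 h2
    _ = 3 * n := by simp

/-- The vertices of the mesh stay in a bounded region. -/
theorem dist_vertex_lt {K : Geometry.SimplicialComplex ℝ E3} {n : ℕ} (hn : 0 < n)
    {S : Set E3} (f : K.space ≃ₜ S) {β : ℝ}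
    (hdist : DistanceHypothesis K n β f) (hnβ : 4 * β ≤ √(n : ℝ)) {c : E3} {ρ : ℝ}
    (hS : S ⊆ ball c ρ) {T : Finset E3} (hT : T ∈ K.faces) (hT3 : T.card = 3) {a : E3}
    (ha : a ∈ T) : dist a c < 2 * ρ := by
  have hsqrt : 0 < √(n : ℝ) := Real.sqrt_pos.2 (by exact_mod_cast hn)
  obtain ⟨b, hb, hba⟩ := Finset.exists_mem_ne (by rw [hT3]; norm_num) a
  have hle := minHeight_le_dist ha hb hba.symm
  have d1 := dist_extendMap_lt f hdist hT hT3 (subset_convexHull ℝ _ ha)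
  have d2 := dist_extendMap_lt f hdist hT hT3 (subset_convexHull ℝ _ hb)
  -- The images of `a` and `b` are less than 2ρ apart and each vertex moves by at most `dist a b /
  -- 4`, so `dist a b < 4ρ`. Hence `a` is within ρ of its image.
  have hquarter : β * minHeight T / √(n : ℝ) ≤ dist a b / 4 := by
    rw [div_le_iff₀ hsqrt]
    have := minHeight_nonneg T
    nlinarith
  have hTP := Geometry.SimplicialComplex.subset_space hT
  have s1 := mem_ball.1 (hS (extendMap_mem f (hTP ha)))
  have s2 := mem_ball.1 (hS (extendMap_mem f (hTP hb)))
  have t1 := dist_triangle4 a (extendMap f a) (extendMap f b) b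
  have t2 := dist_triangle_right (extendMap f a) (extendMap f b) c
  have t3 := dist_triangle a (extendMap f a) c
  rw [dist_comm (extendMap f b) b] at t1
  linarith

open Classical in
theorem lintegral_silhouetteComplexity_le {K : Geometry.SimplicialComplex ℝ E3} {n : ℕ}
    (hn : 0 < n) (hK : IsTriangleMesh K n) {S : Set E3} (hS : IsCompact S) (f : K.space ≃ₜ S)
    {α β : ℝ} (hα : 0 < α) (hβ : 0 < β) (hedge : EdgeLengthHypothesis K n α)
    (hdist : DistanceHypothesis K n β f) (hnβ : 4 * β ≤ √(n : ℝ)) {c : E3} {r ρ : ℝ} (hr : 0 < r)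
    (hρ : 0 < ρ) (hSρ : S ⊆ ball c ρ) :
    ∫⁻ V in ball c r, silhouetteComplexity K V ≤ ENNReal.ofReal √(n : ℝ) *
      (ENNReal.ofReal (2 / α) * Measure.hausdorffMeasure 1 (surfaceBoundary S) * volume (ball c r) +
        ENNReal.ofReal ((2 * ρ + r) ^ 3) *
          (16 * (ENNReal.ofReal (36 / α) *
            ∫⁻ d, silhouetteLength S d ∂((volume : Measure E3).toSphere)) +
          ENNReal.ofReal (288 * β) * volume (ball (0 : E3) 6))) := by
  have hsqrt : 0 < √(n : ℝ) := Real.sqrt_pos.2 (by exact_mod_cast hn)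
  set B := ball c r with hB
  set v₆ := volume (ball (0 : E3) 6) with hv₆
  set R := 2 * ρ + r with hR
  have hRpos : 0 < R := by positivity
  set edges := (finite_meshEdges hK.finite).toFinset with hedges
  have hcard : edges.card ≤ 3 * n := by
    rw [hedges, ← ncard_eq_toFinset_card _ (finite_meshEdges hK.finite)]
    exact ncard_meshEdges_le hK
  -- boundary edges
  have hbd : ((edges.filter (IsBoundaryEdge K)).card : ℝ≥0∞) ≤ ENNReal.ofReal √(n : ℝ) *
      (ENNReal.ofReal (2 / α) * Measure.hausdorffMeasure 1 (surfaceBoundary S)) := by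
    have h1 := boundaryEdges_le hn hK f hβ hedge hdist hnβ
    have h2 : {e ∈ meshEdges K | IsBoundaryEdge K e}.ncard =
        (edges.filter (IsBoundaryEdge K)).card := by
      rw [← ncard_coe_finset]
      congr 1
      ext e
      simp [hedges]
    rw [h2] at h1
    have hinv : ENNReal.ofReal (α / (2 * √(n : ℝ))) *
        (ENNReal.ofReal √(n : ℝ) * ENNReal.ofReal (2 / α)) = 1 := by
      rw [← ENNReal.ofReal_mul (by positivity), ← ENNReal.ofReal_mul (by positivity),
        ENNReal.ofReal_eq_one]
      field_simp
    calc ((edges.filter (IsBoundaryEdge K)).card : ℝ≥0∞)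
        = ((edges.filter (IsBoundaryEdge K)).card : ℝ≥0∞) * ENNReal.ofReal (α / (2 * √(n : ℝ))) *
            (ENNReal.ofReal √(n : ℝ) * ENNReal.ofReal (2 / α)) := by rw [mul_assoc, hinv, mul_one]
      _ ≤ Measure.hausdorffMeasure 1 (surfaceBoundary S) *
            (ENNReal.ofReal √(n : ℝ) * ENNReal.ofReal (2 / α)) := by gcongr
      _ = _ := by ring
  -- edges between a front face and a back face
  have hfb : ∑ e ∈ edges, volume ({V | IsFrontBackEdge K V e} ∩ B) ≤ ENNReal.ofReal √(n : ℝ) *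
      (ENNReal.ofReal (R ^ 3) * (16 * (ENNReal.ofReal (36 / α) *
            ∫⁻ d, silhouetteLength S d ∂((volume : Measure E3).toSphere)) +
          ENNReal.ofReal (288 * β) * v₆)) := by
    set F := edges.filter fun e => ∃ V, IsFrontBackEdge K V e with hF
    have h1 : ∑ e ∈ F, volume ({V | IsFrontBackEdge K V e} ∩ B) =
        ∑ e ∈ edges, volume ({V | IsFrontBackEdge K V e} ∩ B) := by
      refine Finset.sum_filter_of_ne fun e _ hne => ?_
      by_contra hno
      apply hne
      have : {V | IsFrontBackEdge K V e} = ∅ := by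
        ext V
        simp only [mem_ofPred_eq, mem_empty_iff_false, iff_false]
        exact fun h => hno ⟨V, h⟩
      rw [this, empty_inter, measure_empty]
    rw [← h1, ← Finset.sum_coe_sort]
    have hdata : ∀ e : F, ∃ q : (E3 × E3) × (Fin 2 → E3),
        IsInteriorEdge K e q.1.1 q.1.2 q.2 := by
      rintro ⟨e, he⟩
      obtain ⟨V, hV⟩ := (Finset.mem_filter.1 he).2
      obtain ⟨a, b, c, h⟩ := hV.exists_isInteriorEdge
      exact ⟨((a, b), c), h⟩
    choose q hq using hdata
    set δ := 12 * β / √(n : ℝ) with hδ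
    have hδpos : 0 < δ := by positivity
    set σ : F → ℝ≥0∞ := fun e => (volume : Measure E3).toSphere
      (transverseDirections ((q e).1.2 - (q e).1.1) (triNormal (q e).1.1 (q e).1.2 ((q e).2 0))
        (triNormal (q e).1.1 (q e).1.2 ((q e).2 1)) δ) with hσ
    have hsum : ∑ e, σ e ≤ ENNReal.ofReal √(n : ℝ) * (ENNReal.ofReal (36 / α) *
        ∫⁻ d, silhouetteLength S d ∂((volume : Measure E3).toSphere)) :=
      sum_toSphere_transverseDirections_le hS f hn hK hα hβ hedge hdist
        Subtype.val_injective hq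
    have hvol : ∀ e : F, volume ({V | IsFrontBackEdge K V e} ∩ B) ≤
        ENNReal.ofReal (R ^ 3) * (16 * σ e + 8 * ENNReal.ofReal δ * v₆) := by
      intro e
      have hne := (hq e).triNormal_ne_zero f hn hβ hdist
      refine le_trans ?_ (volume_wedge_le (sub_ne_zero.2 (hq e).ne.symm)
        (inner_triNormal_edge _ _ _) (inner_triNormal_edge _ _ _) (hne 0) (hne 1) hδpos hRpos)
      -- Move the vertex `a` of the edge to the origin. As `a` is within 2ρ of the center of `B`,
      -- the translated viewpoints stay in the ball of radius R = 2ρ + r.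
      rw [← measure_preimage_add_right volume (-(q e).1.1) {w ∈ ball (0 : E3) R | 0 <
        inner ℝ (triNormal (q e).1.1 (q e).1.2 ((q e).2 0)) w *
          inner ℝ (triNormal (q e).1.1 (q e).1.2 ((q e).2 1)) w}]
      refine measure_mono ?_
      rintro V ⟨hV, hVB⟩
      simp only [mem_preimage, mem_ofPred_eq, ← sub_eq_add_neg]
      refine ⟨?_, (hq e).inner_mul_inner_pos hK hV⟩
      have h2 := dist_vertex_lt hn f hdist hnβ hSρ ((hq e).mem_faces 0) ((hq e).card_eq 0)
        (a := (q e).1.1) (by simp)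
      rw [mem_ball_zero_iff, ← dist_eq_norm]
      have h3 := dist_triangle_right V (q e).1.1 c
      have h4 := mem_ball.1 hVB
      linarith
    have hFcard : ((Fintype.card F : ℕ) : ℝ≥0∞) * (8 * ENNReal.ofReal δ * v₆) ≤
        ENNReal.ofReal √(n : ℝ) * (ENNReal.ofReal (288 * β) * v₆) := by
      have h2 : Fintype.card F ≤ 3 * n := by
        rw [Fintype.card_coe]
        exact (Finset.card_filter_le _ _).trans hcard
      have h3 : ((Fintype.card F : ℕ) : ℝ≥0∞) ≤ ENNReal.ofReal (3 * n) := by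
        rw [show (3 * n : ℝ) = ((3 * n : ℕ) : ℝ) by push_cast; ring, ENNReal.ofReal_natCast]
        exact_mod_cast h2
      -- The slab errors of up to 3n edges: 3n · 8 · 12β/√n = 288β√n.
      have h4 : ENNReal.ofReal (3 * n) * (8 * ENNReal.ofReal δ) =
          ENNReal.ofReal √(n : ℝ) * ENNReal.ofReal (288 * β) := by
        rw [← ENNReal.ofReal_ofNat, ← ENNReal.ofReal_mul (by positivity),
          ← ENNReal.ofReal_mul (by positivity), ← ENNReal.ofReal_mul (by positivity)]
        congr 1
        have h5 : √(n : ℝ) * √(n : ℝ) = n := Real.mul_self_sqrt (by positivity)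
        rw [hδ]
        field_simp
        rw [sq, h5]
        ring
      calc _ ≤ ENNReal.ofReal (3 * n) * (8 * ENNReal.ofReal δ * v₆) := by gcongr
        _ = ENNReal.ofReal (3 * n) * (8 * ENNReal.ofReal δ) * v₆ := by ring
        _ = _ := by rw [h4, mul_assoc]
    calc ∑ e : F, volume ({V | IsFrontBackEdge K V e} ∩ B)
        ≤ ∑ e : F, ENNReal.ofReal (R ^ 3) * (16 * σ e + 8 * ENNReal.ofReal δ * v₆) :=
          Finset.sum_le_sum fun e _ => hvol e
      _ = ENNReal.ofReal (R ^ 3) * (16 * ∑ e, σ e +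
            ((Fintype.card F : ℕ) : ℝ≥0∞) * (8 * ENNReal.ofReal δ * v₆)) := by
          rw [← Finset.mul_sum, Finset.sum_add_distrib, ← Finset.mul_sum, Finset.sum_const,
            Finset.card_univ, nsmul_eq_mul]
      _ ≤ ENNReal.ofReal (R ^ 3) * (16 * (ENNReal.ofReal √(n : ℝ) * (ENNReal.ofReal (36 / α) *
            ∫⁻ d, silhouetteLength S d ∂((volume : Measure E3).toSphere))) +
            ENNReal.ofReal √(n : ℝ) * (ENNReal.ofReal (288 * β) * v₆)) := by gcongr
      _ = _ := by ring
  calc ∫⁻ V in B, silhouetteComplexity K V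
      = ∫⁻ V in B, ∑ e ∈ edges,
          {V | IsBoundaryEdge K e ∨ IsFrontBackEdge K V e}.indicator (1 : E3 → ℝ≥0∞) V :=
        lintegral_congr_ae (ae_restrict_of_ae (silhouetteComplexity_ae_eq hK))
    _ = ∑ e ∈ edges, volume ({V | IsBoundaryEdge K e ∨ IsFrontBackEdge K V e} ∩ B) := by
        rw [lintegral_finsetSum _ fun e _ =>
          measurable_one.indicator (measurableSet_boundary_or_frontBack K e)]
        refine Finset.sum_congr rfl fun e _ => ?_
        rw [lintegral_indicator_one (measurableSet_boundary_or_frontBack K e),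
          Measure.restrict_apply (measurableSet_boundary_or_frontBack K e)]
    _ ≤ ∑ e ∈ edges, ((if IsBoundaryEdge K e then volume B else 0) +
          volume ({V | IsFrontBackEdge K V e} ∩ B)) := by
        refine Finset.sum_le_sum fun e _ => ?_
        split_ifs with hb
        · exact (measure_mono inter_subset_right).trans le_self_add
        · simp [hb]
    _ = ((edges.filter (IsBoundaryEdge K)).card : ℝ≥0∞) * volume B +
          ∑ e ∈ edges, volume ({V | IsFrontBackEdge K V e} ∩ B) := by
        rw [Finset.sum_add_distrib, ← Finset.sum_filter, Finset.sum_const, nsmul_eq_mul]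
    _ ≤ _ := add_le_add (mul_le_mul_left hbd _) hfb
    _ = _ := by ring

/-! ### The main theorem: choice of the constant -/

theorem theorem2 (S : Set E3) (hS : IsCompactSurface S)
    (hboundary : Measure.hausdorffMeasure 1 (surfaceBoundary S) < ∞)
    (hsilh : averageSilhouetteLength S < ∞)
    (α β : ℝ) (hα : 0 < α) (hβ : 0 < β) (c : E3) (r : ℝ) (hr : 0 < r) :
    ∃ C : ℝ, ∀ (n : ℕ) (P : Geometry.SimplicialComplex ℝ E3) (f : P.space ≃ₜ S),
      IsTriangleMesh P n → EdgeLengthHypothesis P n α → DistanceHypothesis P n β f →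
        AEMeasurable (silhouetteComplexity P) (volume.restrict (ball c r)) ∧
        ⨍⁻ V in ball c r, silhouetteComplexity P V ∂volume ≤ ENNReal.ofReal (C * √(n : ℝ)) := by
  obtain ⟨ρ₀, hρ₀⟩ := hS.1.isBounded.subset_ball c
  set ρ := max ρ₀ 1 with hρdef
  have hρ : 0 < ρ := lt_of_lt_of_le one_pos (le_max_right _ _)
  have hSρ : S ⊆ ball c ρ := hρ₀.trans (ball_subset_ball (le_max_left _ _))
  set v₆ := volume (ball (0 : E3) 6) with hv₆
  have hv₆fin : v₆ < ∞ := measure_ball_lt_top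
  set Λ := ∫⁻ d, silhouetteLength S d ∂((volume : Measure E3).toSphere) with hΛdef
  -- The sphere has finite nonzero measure, so a finite average gives a finite integral.
  have hΛ : Λ < ∞ := by
    rw [averageSilhouetteLength, laverage_eq] at hsilh
    have h1 := ENNReal.mul_lt_top hsilh
      (measure_lt_top ((volume : Measure E3).toSphere) univ)
    rwa [ENNReal.div_mul_cancel (by simp [Real.pi_pos]) (measure_ne_top _ _)] at h1
  set H := (Measure.hausdorffMeasure 1 : Measure E3) (surfaceBoundary S) with hH
  set M : ℝ≥0∞ := (ENNReal.ofReal (2 / α) * H * volume (ball c r) +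
        ENNReal.ofReal ((2 * ρ + r) ^ 3) * (16 * (ENNReal.ofReal (36 / α) * Λ) +
          ENNReal.ofReal (288 * β) * v₆)) / volume (ball c r) with hM
  have hBpos : volume (ball c r) ≠ 0 := (measure_ball_pos volume c hr).ne'
  have hBfin : volume (ball c r) ≠ ∞ := measure_ball_lt_top.ne
  have hMfin : M ≠ ∞ := by
    refine ENNReal.div_ne_top ?_ hBpos
    have h1 := hboundary.ne
    have h2 := hΛ.ne
    have h3 := hv₆fin.ne
    finiteness
  -- The term `M` serves √n ≥ 4β. For √n < 4β, the trivial bound gives 3n = 3√n · √n ≤ 12β√n. The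
  -- case n = 0 is separate, since there the divisions by √n are meaningless.
  refine ⟨12 * β + M.toReal, fun n P f hP hedge hdist => ⟨
    (aemeasurable_silhouetteComplexity hP).restrict, ?_⟩⟩
  rcases Nat.eq_zero_or_pos n with rfl | hn
  · rw [setLAverage_eq]
    have h0 : ∀ V, silhouetteComplexity P V = 0 := fun V => by
      simpa using silhouetteComplexity_le hP V
    simp [h0]
  rw [setLAverage_eq]
  have hsqrt : 0 < √(n : ℝ) := Real.sqrt_pos.2 (by exact_mod_cast hn)
  rcases le_or_gt (4 * β) √(n : ℝ) with hnβ | hnβ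
  · have h1 := lintegral_silhouetteComplexity_le hn hP hS.1 f hα hβ hedge hdist hnβ hr hρ hSρ
    calc _ ≤ (ENNReal.ofReal √(n : ℝ) * (ENNReal.ofReal (2 / α) * H * volume (ball c r) +
        ENNReal.ofReal ((2 * ρ + r) ^ 3) * (16 * (ENNReal.ofReal (36 / α) * Λ) +
          ENNReal.ofReal (288 * β) * v₆))) / volume (ball c r) := by gcongr
      _ = ENNReal.ofReal √(n : ℝ) * M := by rw [hM, mul_div_assoc]
      _ = ENNReal.ofReal (M.toReal * √(n : ℝ)) := by
          rw [ENNReal.ofReal_mul ENNReal.toReal_nonneg, ENNReal.ofReal_toReal hMfin, mul_comm]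
      _ ≤ _ := ENNReal.ofReal_le_ofReal (by gcongr; linarith)
  · have h1 : ∫⁻ V in ball c r, silhouetteComplexity P V ≤ 3 * n * volume (ball c r) := by
      rw [← setLIntegral_const]
      exact lintegral_mono fun V => silhouetteComplexity_le hP V
    calc _ ≤ 3 * n * volume (ball c r) / volume (ball c r) := by gcongr
      _ = 3 * n := ENNReal.mul_div_cancel_right hBpos hBfin
      _ = ENNReal.ofReal (3 * n) := by
          rw [ENNReal.ofReal_mul (by norm_num), ENNReal.ofReal_natCast, ENNReal.ofReal_ofNat]
      _ ≤ _ := by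
          apply ENNReal.ofReal_le_ofReal
          have h5 : √(n : ℝ) * √(n : ℝ) = n := Real.mul_self_sqrt (by positivity)
          have h6 : 0 ≤ M.toReal * √(n : ℝ) := by positivity
          nlinarith
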